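/- Let $n>1$ and let $\Phi:\{0,1\}^n\to\{0,1\}$ be the structure function of a semi-coherent system, i.e. $\Phi$ is nondecreasing, $\Phi(\mathbf 0)=0$ and $\Phi(\mathbf 1)=1$, where $x_i=1$ (resp. $\Phi(\mathbf x)=1$) means that component $i$ (resp. the system) works. Let $s_k:=\overline S_{k-1}-\overline S_k$, $k=1,\dots,n$, be its structural signature, where $\overline S_k:=\binom{n}{n-k}^{-1}\sum_{|\mathbf x|=n-k}\Phi(\mathbf x)$. Assume that the component lifetimes $T_1,\dots,T_n$ have a Lévy-frailty Marshall-Olkin distribution: $T_i=\inf\{t\ge 0: L_t>\varepsilon_i\}$, where $(L_t)_{t\ge 0}$ is a Lévy subordinator with $L_0=0$ that is not almost surely identically zero, and $\varepsilon_1,\dots,\varepsilon_n$ are iid standard exponential random variables independent of $L$. Let $\Psi(x)=-\log\mathbb E[e^{-xL_1}]$ be the Laplace exponent, $T_{1:n}\le\dots\le T_{n:n}$ the ordered lifetimes, $N(t)=\#\{i: L_t\ge\varepsilon_i\}$ the number of failed components at time $t$ (so $N(0)=0$ almost surely), with $N(\infty):=n$, and let $T_{fail}=\inf\{t\ge0:\Phi(\mathbf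 1\{t<T_1\},\dots,\mathbf 1\{t<T_n\})=0\}$ be the time when the system fails (there are no repairs). Put $\tau_0=0$, $\tau_{m+1}=\inf\{t>\tau_m: N(t)-N(t^-)>0\}$ (with $\inf\emptyset=\infty$) and $N^{disc}_m=N(\tau_m)$, and for $0\le i<j\le n$ let $$Q_{i,j}:=\mathbb P\big(\exists m\ge 0:\ N^{disc}_m\le i,\ N^{disc}_{m+1}=j\big)$$ be the probability that the embedded chain of failure counts jumps in one step from $\{0,\dots,i\}$ to $j$. Then for every $j=1,\dots,n$, $$\mathbb P(N(T_{fail})=j)=\sum_{k=1}^{j}s_k\,\mathbb P(N(T_{k:n})=j)=\sum_{k=1}^{j}s_k\,Q_{k-1,j},$$ and the numbers $Q_{k-1,j}$, $1\le k\le j$, are given explicitly by the recursion $Q_{0,j}=P_{0,j}$ and $Q_{i,j}=Q_{i-1,j}+Q_{i-1,i}P_{i,j}$ for $1\le i<j$, where for $0\le i<j\le n$ $$P_{i,j}=\binom{n-i}{j-i}\frac{\lambda^{(n-i)}_{j-i}}{\Psi(n-i)},\qquad \lambda^{(l)}_v=\sum_{i=0}^{v-1}\binom{v-1}{i}(-1)^i\big(\Psi(l-v+i+1)-\Psi(l-v+i)\big).$$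 -/

import Mathlib

open MeasureTheory ProbabilityTheory Set
open scoped NNReal ENNReal

noncomputable section

/-! ### Binary systems and their structural signature

A state is a vector `x : Fin n → Bool`, with `x i = true` iff component `i` is working; a structure
function `Φ` sends a state to `true` iff the system is working in that state. -/

/-- Monotone, failed when all components are failed, working when all components are working. -/
structure IsSemiCoherent {n : ℕ} (Φ : (Fin n → Bool) → Bool) : Prop where
  monotone : Monotone Φ
  all_failed : Φ (fun _ => false) = false
  all_working : Φ (fun _ => true) = true

/-- The proportion, among the states with exactly `k` failed components, of those in which the
system is working. -/
def survivalProportion {n : ℕ} (Φ : (Fin n → Bool) → Bool) (k : ℕ) : ℝ :=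
  (1 / (n.choose (n - k) : ℝ)) *
    ∑ x : Fin n → Bool with (Finset.univ.filter (fun i => x i = true)).card = n - k,
      if Φ x = true then (1 : ℝ) else 0

/-- The structural signature `s_k`, for `k = 1, …, n`. -/
def structuralSignature {n : ℕ} (Φ : (Fin n → Bool) → Bool) (k : ℕ) : ℝ :=
  survivalProportion Φ (k - 1) - survivalProportion Φ k

/-! ### Lévy subordinators and the Lévy-frailty Marshall-Olkin model -/

/-- A (finite, non-killed) Lévy subordinator: a Lévy process started at `0` whose paths are almost
surely nondecreasing. A nondecreasing path has left limits everywhere, so that being càdlàg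
amounts to being right-continuous. -/
structure IsLevySubordinator {Ω : Type*} [MeasurableSpace Ω] (L : ℝ≥0 → Ω → ℝ) (P : Measure Ω) :
    Prop where
  measurable : ∀ t, Measurable (L t)
  zero : ∀ᵐ ω ∂P, L 0 ω = 0
  indep_increments : HasIndepIncrements L P
  stationary_increments : ∀ s t : ℝ≥0,
    IdentDistrib (fun ω => L (s + t) ω - L s ω) (fun ω => L t ω - L 0 ω) P P
  monotone : ∀ᵐ ω ∂P, Monotone (fun t => L t ω)
  right_continuous : ∀ᵐ ω ∂P, ∀ t, ContinuousWithinAt (fun u => L u ω) (Ici t) t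

/-- The Laplace exponent `Ψ(x) = -log E[exp (-x L₁)]`. -/
def laplaceExponent {Ω : Type*} [MeasurableSpace Ω] (L : ℝ≥0 → Ω → ℝ) (P : Measure Ω) (x : ℝ) : ℝ :=
  -Real.log (∫ ω, Real.exp (-(x * L 1 ω)) ∂P)

/-- The ingredients of a Lévy-frailty Marshall-Olkin vector: a Lévy subordinator `L`, and `n` iid
standard exponential triggers `ε` that are independent of (the whole path of) `L`. -/
structure IsLFMOModel {Ω : Type*} [MeasurableSpace Ω] {n : ℕ} (L : ℝ≥0 → Ω → ℝ) (ε : Fin n → Ω → ℝ)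
    (P : Measure Ω) : Prop where
  subordinator : IsLevySubordinator L P
  measurable_trigger : ∀ i, Measurable (ε i)
  trigger_law : ∀ i, HasLaw (ε i) (expMeasure 1) P
  iIndep_trigger : iIndepFun ε P
  indep : IndepFun (fun ω t => L t ω) (fun ω i => ε i ω) P

section Model

variable {Ω : Type*} {n : ℕ} (L : ℝ≥0 → Ω → ℝ) (ε : Fin n → Ω → ℝ)

/-- The lifetime `T_i = inf {t ≥ 0 : L_t > ε_i}`, with `inf ∅ = ∞`. -/
def lifetime (i : Fin n) (ω : Ω) : ℝ≥0∞ :=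
  ⨅ (t : ℝ≥0) (_ : ε i ω < L t ω), (t : ℝ≥0∞)

/-- The `k`-th order statistic `T_{k:n}` of `T_1, …, T_n`, for `1 ≤ k ≤ n`. -/
def orderStatistic (T : Fin n → ℝ≥0∞) (k : ℕ) : ℝ≥0∞ :=
  if h : k - 1 < n then T (Tuple.sort T ⟨k - 1, h⟩) else ⊤

/-- The number `N(t) = ∑ i, 1{L_t ≥ ε_i}` of failed components at time `t`. -/
def failureCount (ω : Ω) (t : ℝ≥0) : ℕ :=
  (Finset.univ.filter (fun i => ε i ω ≤ L t ω)).card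

/-- `N(t)` at a time `t ∈ [0, ∞]`, with `N(∞) = n`. -/
def failureCountAt (ω : Ω) (t : ℝ≥0∞) : ℕ :=
  if t = ⊤ then n else failureCount L ε ω t.toNNReal

/-- The time when the system fails: the first time at which the system is in a failed state, where
component `i` is working at time `t` iff `t < T_i`. -/
def systemFailureTime (Φ : (Fin n → Bool) → Bool) (ω : Ω) : ℝ≥0∞ :=
  ⨅ (t : ℝ≥0) (_ : Φ (fun i => decide ((t : ℝ≥0∞) < lifetime L ε i ω)) = false), (t : ℝ≥0∞)

/-- The successive times at which one or more components fail: `τ_0 = 0` and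
`τ_{m+1} = inf {t > τ_m : N(t) - N(t⁻) > 0}`, with `inf ∅ = ∞`. -/
def jumpTime (ω : Ω) : ℕ → ℝ≥0∞
  | 0 => 0
  | m + 1 =>
    ⨅ (t : ℝ≥0) (_ : jumpTime ω m < t ∧
      Function.leftLim (failureCount L ε ω) t < failureCount L ε ω t), (t : ℝ≥0∞)

/-- The embedded chain `N^disc_m = N(τ_m)` of failure counts. -/
def embeddedChain (ω : Ω) (m : ℕ) : ℕ :=
  failureCountAt L ε ω (jumpTime L ε ω m)

/-- The probability that the embedded chain of failure counts jumps, in one step, from the set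
`{0, …, i}` into the state `j`, for `i < j`; zero otherwise. -/
def directJumpProb [MeasurableSpace Ω] (P : Measure Ω) (i j : ℕ) : ℝ :=
  P.real {ω | i < j ∧ ∃ m, embeddedChain L ε ω m ≤ i ∧ embeddedChain L ε ω (m + 1) = j}

end Model

/-! ### The explicit expressions in terms of the Laplace exponent -/

/-- The shock rate `λ^{(l)}_v`, for `1 ≤ v ≤ l`: the rate of the shocks that hit exactly a given
set of `v` out of `l` components. -/
def shockRate (Ψ : ℝ → ℝ) (l v : ℕ) : ℝ :=
  ∑ i ∈ Finset.range v, ((v - 1).choose i : ℝ) * (-1) ^ i *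
    (Ψ ((l - v + i + 1 : ℕ) : ℝ) - Ψ ((l - v + i : ℕ) : ℝ))

/-- The transition probability `P_{i,j} = C(n-i, j-i) λ^{(n-i)}_{j-i} / Ψ(n-i)` for
`0 ≤ i < j ≤ n`, and zero otherwise. -/
def transitionProb (n : ℕ) (Ψ : ℝ → ℝ) (i j : ℕ) : ℝ :=
  if i < j ∧ j ≤ n then
    ((n - i).choose (j - i) : ℝ) * shockRate Ψ (n - i) (j - i) / Ψ ((n - i : ℕ) : ℝ)
  else 0

/-- The recursion `Q_{0,j} = P_{0,j}` and `Q_{i,j} = Q_{i-1,j} + Q_{i-1,i} P_{i,j}` for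
`1 ≤ i < j`; zero if `j ≤ i`. -/
def recursiveJumpProb (n : ℕ) (Ψ : ℝ → ℝ) : ℕ → ℕ → ℝ
  | 0, j => transitionProb n Ψ 0 j
  | i + 1, j =>
    if i + 1 < j then
      recursiveJumpProb n Ψ i j + recursiveJumpProb n Ψ i (i + 1) * transitionProb n Ψ (i + 1) j
    else 0

end

/-! ### Counting the lifetimes that have elapsed -/

section Counting

open Filter Topology

variable {n : ℕ}

/-! Everything is read off the vector of lifetimes. Almost surely these are positive and finite, and
`N(t)` is the number of `i` with `T_i ≤ t` (`IsLFMOModel.ae_failureCount_eq`): no trigger equals the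
value of `L` at a rational time, and right-continuity does the rest. What remains is deterministic
counting, ties included, and three probabilistic facts.

Signature. Fix the lifetimes and relabel the components by all `n!` permutations. Each relabelled
system fails at `T_{κ:n}`, with `κ` the number of failures, in that order, that first brings it
down; `κ = k` for a proportion `s_k` of the permutations (`sum_perm_elapsedCount_failureTimeOf`).
The lifetimes are exchangeable, so relabelling preserves the law and the average is the law itself
(`IsLFMOModel.measureReal_count_failureTimeOf`). As `N(T_{k:n}) ≥ k`, the mixture stops at `k = j`.

Jumps. The embedded chain leaves `{0, …, i}` exactly at time `T_{i+1:n}`, so `Q_{i,j} =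
P(N(T_{i+1:n}) = j)` (`exists_jump_iff`). Either `N(T_{i:n}) > i`, and then `T_{i+1:n} = T_{i:n}`,
or `i` is visited; this dichotomy is the recursion, once the visit to `i` followed by a jump to `j`
is known to have probability P(visit `i`) times `P_{i,j}`.

Transition probabilities. By memorylessness of the triggers and the stationary independent
increments of `L`, the counts satisfy `P(N(s) = i, N(s+δ) = j) = P(N(s) = i) p_{ij}(δ)`. Summing
over the grid of mesh `δ` gives P(grid jump from `i` to `j`) `(1 - p_{ii}) =` P(grid visit to `i`)
`p_{ij}`. Divide by `δ` and let `δ → 0`: the rates tend to `Ψ(n-i)` and to the binomial coefficient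
times the shock rate, and for almost every path the grid events eventually agree with the
continuous-time ones (`IsLFMOModel.measureReal_visit_and_jump`). This replaces a strong Markov
argument. -/

/-- The number of lifetimes that are at most `t`. -/
noncomputable def elapsedCount (T : Fin n → ℝ≥0∞) (t : ℝ≥0∞) : ℕ :=
  (Finset.univ.filter (fun i => T i ≤ t)).card

variable {T : Fin n → ℝ≥0∞}

lemma elapsedCount_mono (T : Fin n → ℝ≥0∞) : Monotone (elapsedCount T) := fun _ _ h =>
  Finset.card_le_card (Finset.monotone_filter_right _ fun _ _ hi => le_trans hi h)

lemma elapsedCount_le (T : Fin n → ℝ≥0∞) (t : ℝ≥0∞) : elapsedCount T t ≤ n :=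
  (Finset.card_le_univ _).trans (by simp)

lemma elapsedCount_top (T : Fin n → ℝ≥0∞) : elapsedCount T ⊤ = n := by
  simp [elapsedCount]

lemma elapsedCount_zero (hT : ∀ i, T i ≠ 0) : elapsedCount T 0 = 0 := by
  simp [elapsedCount, hT]

lemma elapsedCount_comp (T : Fin n → ℝ≥0∞) (σ : Equiv.Perm (Fin n)) (t : ℝ≥0∞) :
    elapsedCount (fun i => T (σ i)) t = elapsedCount T t := by
  unfold elapsedCount
  exact Finset.card_equiv σ (by simp)

lemma elapsedCount_lt_of_lt {i : Fin n} {x y : ℝ≥0∞} (hx : x < T i) (hy : T i ≤ y) :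
    elapsedCount T x < elapsedCount T y := by
  refine Finset.card_lt_card (Finset.ssubset_iff_of_subset ?_ |>.2 ⟨i, by simpa, by simpa⟩)
  exact Finset.monotone_filter_right _ fun _ _ hi => le_trans hi (hx.le.trans hy)

/-- The Galois connection between counts and order statistics; it holds with ties, and the later
comparisons of times rest on it. -/
lemma le_elapsedCount_iff {k : ℕ} (hk : 1 ≤ k) (hkn : k ≤ n) (y : ℝ≥0∞) :
    k ≤ elapsedCount T y ↔ orderStatistic T k ≤ y := by
  have h : k - 1 < n := by omega
  have key := Tuple.lt_card_le_iff_apply_le_of_monotone (j := ⟨k - 1, h⟩) (a := y)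
    (Tuple.monotone_sort T)
  have h2 := elapsedCount_comp T (Tuple.sort T) y
  unfold elapsedCount at *
  simp only [Function.comp_apply] at key
  rw [h2] at key
  rw [orderStatistic, dif_pos h, ← key]
  omega

lemma elapsedCount_lt_iff {k : ℕ} (hk : 1 ≤ k) (hkn : k ≤ n) (y : ℝ≥0∞) :
    elapsedCount T y < k ↔ y < orderStatistic T k := by
  rw [← not_le, le_elapsedCount_iff hk hkn, not_le]

lemma exists_orderStatistic_eq {k : ℕ} (hk : 1 ≤ k) (hkn : k ≤ n) :
    ∃ i, orderStatistic T k = T i :=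
  ⟨_, by rw [orderStatistic, dif_pos (by omega)]⟩

lemma le_elapsedCount_orderStatistic {k : ℕ} (hk : 1 ≤ k) (hkn : k ≤ n) :
    k ≤ elapsedCount T (orderStatistic T k) :=
  (le_elapsedCount_iff hk hkn _).2 le_rfl

/-- If the times `τ 0 = 0, τ 1, …` run through the successive distinct lifetimes, the counts jump
from at most `i` to `j` exactly if the count at the `(i + 1)`-st order statistic is `j`. -/
lemma exists_jump_iff {τ : ℕ → ℝ≥0∞} (h0 : τ 0 = 0) (hT0 : ∀ i, T i ≠ 0)
    (hle : ∀ m i, τ m < T i → τ (m + 1) ≤ T i)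
    (hstep : ∀ m, τ (m + 1) = ⊤ ∨ ∃ i, τ (m + 1) = T i ∧ τ m < T i)
    {i j : ℕ} (hij : i < j) (hjn : j ≤ n) :
    (∃ m, elapsedCount T (τ m) ≤ i ∧ elapsedCount T (τ (m + 1)) = j) ↔
      elapsedCount T (orderStatistic T (i + 1)) = j := by
  have hi1 : 1 ≤ i + 1 := by omega
  have hin : i + 1 ≤ n := by omega
  obtain ⟨a, ha⟩ := exists_orderStatistic_eq (T := T) hi1 hin
  constructor
  · rintro ⟨m, hm, hm'⟩
    have h1 : τ m < orderStatistic T (i + 1) :=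
      (elapsedCount_lt_iff hi1 hin _).1 (by omega)
    have h2 : orderStatistic T (i + 1) ≤ τ (m + 1) :=
      (le_elapsedCount_iff hi1 hin _).1 (by omega)
    have h3 : τ (m + 1) ≤ orderStatistic T (i + 1) := by
      rw [ha] at h1 ⊢
      exact hle m a h1
    rw [le_antisymm h2 h3, hm']
  · intro hj
    have hex : ∃ m, orderStatistic T (i + 1) ≤ τ m := by
      by_contra! hcon
      -- Each step that stays finite passes a new lifetime and raises the count, so `n + 1` steps
      -- below the order statistic would count more than `n` components.
      have hgrow : ∀ m, m ≤ elapsedCount T (τ m) := by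
        intro m
        induction m with
        | zero => exact Nat.zero_le _
        | succ m ih =>
          rcases hstep m with h | ⟨b, hb, hb'⟩
          · exact absurd (hcon (m + 1)) (by simp [h])
          · exact Nat.succ_le_of_lt (ih.trans_lt (elapsedCount_lt_of_lt hb' hb.ge))
      have := hgrow (n + 1)
      have := elapsedCount_le T (τ (n + 1))
      omega
    classical
    have hne : Nat.find hex ≠ 0 := by
      intro h
      have h2 := Nat.find_spec hex
      rw [h, h0, ha] at h2
      exact hT0 a (le_antisymm h2 bot_le)
    obtain ⟨m, hm⟩ := Nat.exists_eq_succ_of_ne_zero hne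
    have h1 : τ m < orderStatistic T (i + 1) :=
      not_le.1 (Nat.find_min hex (by omega))
    have h2 : orderStatistic T (i + 1) ≤ τ (m + 1) := by
      have := Nat.find_spec hex
      rwa [hm] at this
    have h3 : τ (m + 1) ≤ orderStatistic T (i + 1) := by
      rw [ha] at h1 ⊢
      exact hle m a h1
    refine ⟨m, ?_, ?_⟩
    · have := (elapsedCount_lt_iff hi1 hin _).2 h1
      omega
    · rw [le_antisymm h3 h2, hj]

/-- The count at an order statistic is stable: if the count at `o_i` exceeds `i`, then
`o_{i+1} = o_i`. -/
lemma elapsedCount_orderStatistic_succ_iff {i j : ℕ} (hi : 1 ≤ i) (hij : i < j) (hjn : j ≤ n) :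
    elapsedCount T (orderStatistic T (i + 1)) = j ↔
      elapsedCount T (orderStatistic T i) = j ∨
        (elapsedCount T (orderStatistic T i) = i ∧
          elapsedCount T (orderStatistic T (i + 1)) = j) := by
  have hin : i + 1 ≤ n := by omega
  have h1 : orderStatistic T i ≤ orderStatistic T (i + 1) := by
    rw [← le_elapsedCount_iff hi (by omega)]
    exact (Nat.le_succ i).trans (le_elapsedCount_orderStatistic (by omega) hin)
  have h2 := le_elapsedCount_orderStatistic (T := T) hi (by omega)
  have h3 : i < elapsedCount T (orderStatistic T i) →
      orderStatistic T (i + 1) = orderStatistic T i := fun h =>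
    le_antisymm ((le_elapsedCount_iff (by omega) hin _).1 h) h1
  constructor
  · intro h
    rcases h2.lt_or_eq with h4 | h4
    · left
      rw [← h3 h4, h]
    · exact Or.inr ⟨h4.symm, h⟩
  · rintro (h | h)
    · rw [h3 (by omega), h]
    · exact h.2

/-- The count is at least `i` from `T_{i:n}` on, so a value `i` reached later is already the value
there. -/
lemma exists_elapsedCount_eq_iff {i : ℕ} (hi : 1 ≤ i) (hin : i ≤ n) :
    (∃ y, elapsedCount T y = i) ↔ elapsedCount T (orderStatistic T i) = i := by
  refine ⟨?_, fun h => ⟨_, h⟩⟩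
  rintro ⟨y, hy⟩
  have h1 := elapsedCount_mono T ((le_elapsedCount_iff hi hin y).1 hy.ge)
  have h2 := le_elapsedCount_orderStatistic (T := T) hi hin
  omega

/-! ### Counts along a fine grid -/

lemma exists_le_nat_mul {x : ℝ≥0∞} (hx : x ≠ ⊤) {δ : ℝ≥0} (hδ : 0 < δ) :
    ∃ m : ℕ, x ≤ ((m * δ : ℝ≥0) : ℝ≥0∞) := by
  lift x to ℝ≥0 using hx
  exact ⟨⌈x / δ⌉₊, ENNReal.coe_le_coe.2 ((div_le_iff₀ hδ).1 (Nat.le_ceil _))⟩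

/-- Right-continuity of the count: finitely many lifetimes leave a gap after `o`. -/
lemma eventually_elapsedCount_add (T : Fin n → ℝ≥0∞) (o : ℝ≥0∞) :
    ∀ᶠ δ : ℝ≥0 in 𝓝 0, elapsedCount T (o + δ) = elapsedCount T o := by
  have h : ∀ᶠ δ : ℝ≥0 in 𝓝 0, ∀ i, T i ≤ o + δ ↔ T i ≤ o := by
    rw [eventually_all]
    intro i
    rcases le_or_gt (T i) o with hi | hi
    · exact Eventually.of_forall fun δ => ⟨fun _ => hi, fun _ => hi.trans le_self_add⟩
    · have hlim : Tendsto (fun δ : ℝ≥0 => o + (δ : ℝ≥0∞)) (𝓝 0) (𝓝 (o + (0 : ℝ≥0))) :=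
        Tendsto.add tendsto_const_nhds (ENNReal.continuous_coe.tendsto 0)
      rw [ENNReal.coe_zero, add_zero] at hlim
      filter_upwards [hlim.eventually (gt_mem_nhds hi)] with δ hδ
      exact ⟨fun h => absurd hδ (not_lt.2 h), fun h => absurd hi (not_lt.2 h)⟩
  filter_upwards [h] with δ hδ
  simp only [elapsedCount, hδ]

/-- If the count takes the value `i` at `y`, it keeps it until `T_{i+1:n} > y`; a mesh finer than
this gap must hit the interval. -/
lemma eventually_exists_grid_visit_iff {i : ℕ} (hin : i < n) :
    ∀ᶠ δ : ℝ≥0 in 𝓝[>] 0, (∃ m : ℕ, elapsedCount T ((m * δ : ℝ≥0) : ℝ≥0∞) = i) ↔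
      ∃ y, elapsedCount T y = i := by
  by_cases hy : ∃ y, elapsedCount T y = i
  swap
  · exact Eventually.of_forall fun δ => ⟨fun ⟨m, hm⟩ => ⟨_, hm⟩, fun h => absurd h hy⟩
  obtain ⟨y, hy⟩ := hy
  have hyo : y < orderStatistic T (i + 1) :=
    (elapsedCount_lt_iff (by omega) (by omega) y).1 (by omega)
  have hyt : y ≠ ⊤ := hyo.ne_top
  lift y to ℝ≥0 using hyt
  have hlim : Tendsto (fun δ : ℝ≥0 => (y : ℝ≥0∞) + (δ : ℝ≥0∞)) (𝓝 0) (𝓝 (y + (0 : ℝ≥0))) :=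
    Tendsto.add tendsto_const_nhds (ENNReal.continuous_coe.tendsto 0)
  rw [ENNReal.coe_zero, add_zero] at hlim
  have h1 := (hlim.eventually (gt_mem_nhds hyo)).filter_mono (nhdsWithin_le_nhds (s := Ioi 0))
  filter_upwards [h1, self_mem_nhdsWithin] with δ hδ hδ0
  replace hδ0 : 0 < δ := hδ0
  -- The first grid point at or after `y`; it is at most `y + δ`.
  refine ⟨fun ⟨m, hm⟩ => ⟨_, hm⟩, fun _ => ⟨⌈y / δ⌉₊, ?_⟩⟩
  have h2 : y ≤ ⌈y / δ⌉₊ * δ := (div_le_iff₀ hδ0).1 (Nat.le_ceil _)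
  have h3 : ⌈y / δ⌉₊ * δ ≤ y + δ := by
    have := (Nat.ceil_lt_add_one (zero_le : 0 ≤ y / δ)).le
    calc _ ≤ (y / δ + 1) * δ := by gcongr
      _ = y + δ := by field_simp
  have h4 : elapsedCount T ((⌈y / δ⌉₊ * δ : ℝ≥0) : ℝ≥0∞) < i + 1 := by
    rw [elapsedCount_lt_iff (by omega) (by omega)]
    refine lt_of_le_of_lt ?_ hδ
    exact_mod_cast h3
  have h5 := elapsedCount_mono T (ENNReal.coe_le_coe.2 h2)
  omega

/-- On a fine grid, the cell containing `T_{i+1:n}` contains no later lifetime, so the grid sees the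
true jump there. Finiteness of the lifetimes makes the grid reach it. -/
lemma eventually_exists_grid_jump_iff (hT : ∀ i, T i ≠ ⊤) {i j : ℕ} (hij : i < j) (hjn : j ≤ n) :
    ∀ᶠ δ : ℝ≥0 in 𝓝[>] 0, (∃ m : ℕ, elapsedCount T ((m * δ : ℝ≥0) : ℝ≥0∞) = i ∧
        elapsedCount T (((m + 1 : ℕ) * δ : ℝ≥0) : ℝ≥0∞) = j) ↔
      (∃ y, elapsedCount T y = i) ∧ elapsedCount T (orderStatistic T (i + 1)) = j := by
  have hi1 : 1 ≤ i + 1 := by omega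
  have hin : i + 1 ≤ n := by omega
  filter_upwards [eventually_exists_grid_visit_iff (show i < n by omega), self_mem_nhdsWithin,
    (eventually_elapsedCount_add T (orderStatistic T (i + 1))).filter_mono
      (nhdsWithin_le_nhds (s := Ioi 0))] with δ hvisit hδ0 hstable
  replace hδ0 : 0 < δ := hδ0
  have key : ∀ m : ℕ, ((m * δ : ℝ≥0) : ℝ≥0∞) < orderStatistic T (i + 1) →
      orderStatistic T (i + 1) ≤ (((m + 1 : ℕ) * δ : ℝ≥0) : ℝ≥0∞) →
      elapsedCount T (((m + 1 : ℕ) * δ : ℝ≥0) : ℝ≥0∞) =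
        elapsedCount T (orderStatistic T (i + 1)) := by
    intro m h1 h2
    refine le_antisymm ?_ (elapsedCount_mono T h2)
    rw [← hstable]
    apply elapsedCount_mono
    rw [Nat.cast_add, Nat.cast_one, add_mul, one_mul, ENNReal.coe_add]
    gcongr
  constructor
  · rintro ⟨m, hm, hm'⟩
    refine ⟨⟨_, hm⟩, ?_⟩
    rw [← key m, hm']
    · exact (elapsedCount_lt_iff hi1 hin _).1 (by omega)
    · exact (le_elapsedCount_iff hi1 hin _).1 (by omega)
  · rintro ⟨hv, hj⟩
    obtain ⟨m₀, hm₀⟩ := hvisit.2 hv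
    have hex : ∃ m : ℕ, orderStatistic T (i + 1) ≤ ((m * δ : ℝ≥0) : ℝ≥0∞) := by
      obtain ⟨a, ha⟩ := exists_orderStatistic_eq (T := T) hi1 hin
      exact exists_le_nat_mul (ha ▸ hT a) hδ0
    classical
    have hlt : ((m₀ * δ : ℝ≥0) : ℝ≥0∞) < orderStatistic T (i + 1) :=
      (elapsedCount_lt_iff hi1 hin _).1 (by omega)
    have hgt : m₀ < Nat.find hex := by
      by_contra! h
      refine absurd hlt (not_lt.2 ((Nat.find_spec hex).trans (ENNReal.coe_le_coe.2 ?_)))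
      gcongr
    obtain ⟨m, hm⟩ := Nat.exists_eq_succ_of_ne_zero (Nat.ne_zero_of_lt hgt)
    have h1 : ((m * δ : ℝ≥0) : ℝ≥0∞) < orderStatistic T (i + 1) :=
      not_le.1 (Nat.find_min hex (by omega))
    have h2 : orderStatistic T (i + 1) ≤ (((m + 1 : ℕ) * δ : ℝ≥0) : ℝ≥0∞) := by
      have := Nat.find_spec hex
      rwa [hm] at this
    refine ⟨m, ?_, (key m h1 h2).trans hj⟩
    have h3 := (elapsedCount_lt_iff hi1 hin _).2 h1
    have h4 : elapsedCount T ((m₀ * δ : ℝ≥0) : ℝ≥0∞) ≤ elapsedCount T ((m * δ : ℝ≥0) : ℝ≥0∞) := by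
      apply elapsedCount_mono
      apply ENNReal.coe_le_coe.2
      have : m₀ ≤ m := by omega
      gcongr
    omega

/-! ### Jump times of the counting path -/

lemma leftLim_elapsedCount_lt_iff (hT0 : ∀ i, T i ≠ 0) (t : ℝ≥0) :
    Function.leftLim (fun s : ℝ≥0 => elapsedCount T s) t < elapsedCount T t ↔ ∃ i, T i = t := by
  rcases eq_or_ne t 0 with rfl | ht
  -- At `0` there is nothing to the left: the left limit is by convention the value itself, and no
  -- lifetime is `0`.
  · have : 𝓝[<] (0 : ℝ≥0) = ⊥ := by simp
    rw [leftLim_eq_of_eq_bot _ this]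
    simp [hT0]
  · have hne : (𝓝[<] t).NeBot := nhdsLT_neBot_of_exists_lt ⟨0, pos_iff_ne_zero.2 ht⟩
    have hlim : Function.leftLim (fun s : ℝ≥0 => elapsedCount T s) t =
        (Finset.univ.filter (fun i => T i < t)).card := by
      refine leftLim_eq_of_tendsto (h := hne) ?_
      apply tendsto_const_nhds.congr'
      have h : ∀ᶠ s : ℝ≥0 in 𝓝[<] t, ∀ i, T i < t ↔ T i ≤ s := by
        rw [eventually_all]
        intro i
        rcases lt_or_ge (T i) t with hi | hi
        · have h1 : ∀ᶠ s : ℝ≥0 in 𝓝 t, T i < s :=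
            (ENNReal.continuous_coe.tendsto t).eventually (lt_mem_nhds hi)
          filter_upwards [h1.filter_mono nhdsWithin_le_nhds] with s hs
          exact ⟨fun _ => hs.le, fun _ => hi⟩
        · filter_upwards [self_mem_nhdsWithin] with s hs
          have : (s : ℝ≥0∞) < t := ENNReal.coe_lt_coe.2 hs
          exact ⟨fun h => absurd hi (not_le.2 h), fun h => absurd (this.trans_le hi) (not_lt.2 h)⟩
      filter_upwards [h] with s hs
      simp only [elapsedCount, hs]
    rw [hlim]
    constructor
    · intro h
      by_contra! hcon
      refine h.ne (congrArg Finset.card (Finset.filter_congr fun i _ => ?_))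
      exact ⟨le_of_lt, fun h => lt_of_le_of_ne h (hcon i)⟩
    · rintro ⟨i, hi⟩
      refine Finset.card_lt_card (Finset.ssubset_iff_of_subset ?_ |>.2 ⟨i, by simp [hi], by simp [hi]⟩)
      exact Finset.monotone_filter_right _ fun _ _ hi => le_of_lt hi

/-- With `p` the predicate "some component fails at `t`", the next jump time is a minimum over
finitely many lifetimes, hence attained unless none remains. These are the two hypotheses of
`exists_jump_iff` on the times `τ`. -/
lemma iInf_lifetime_after (hT : ∀ i, T i ≠ ⊤) (x : ℝ≥0∞) {p : ℝ≥0 → Prop}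
    (hp : ∀ t, p t ↔ ∃ i, T i = t) :
    (∀ i, x < T i → (⨅ (t : ℝ≥0) (_ : x < t ∧ p t), (t : ℝ≥0∞)) ≤ T i) ∧
      ((⨅ (t : ℝ≥0) (_ : x < t ∧ p t), (t : ℝ≥0∞)) = ⊤ ∨
        ∃ i, (⨅ (t : ℝ≥0) (_ : x < t ∧ p t), (t : ℝ≥0∞)) = T i ∧ x < T i) := by
  have hle : ∀ i, x < T i → (⨅ (t : ℝ≥0) (_ : x < t ∧ p t), (t : ℝ≥0∞)) ≤ T i := by
    intro i hi
    have h1 : (((T i).toNNReal : ℝ≥0) : ℝ≥0∞) = T i := ENNReal.coe_toNNReal (hT i)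
    have h2 : x < ((T i).toNNReal : ℝ≥0) ∧ p (T i).toNNReal :=
      ⟨by rwa [h1], (hp _).2 ⟨i, h1.symm⟩⟩
    refine (iInf₂_le (T i).toNNReal h2).trans h1.le
  refine ⟨hle, ?_⟩
  by_cases hex : (Finset.univ.filter (fun i => x < T i)).Nonempty
  · right
    obtain ⟨i, hi, hmin⟩ := Finset.exists_min_image _ T hex
    rw [Finset.mem_filter] at hi
    refine ⟨i, le_antisymm (hle i hi.2) ?_, hi.2⟩
    refine le_iInf₂ fun t ht => ?_
    obtain ⟨k, hk⟩ := (hp t).1 ht.2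
    rw [← hk]
    exact hmin k (by simpa [hk] using ht.1)
  · left
    rw [eq_top_iff]
    refine le_iInf₂ fun t ht => ?_
    obtain ⟨k, hk⟩ := (hp t).1 ht.2
    exact absurd ⟨k, by simpa [hk] using ht.1⟩ hex

end Counting

/-! ### Counting permutations with the structural signature -/

section Signature

variable {n : ℕ}

lemma exists_perm_comp_eq {x y : Fin n → Bool}
    (h : (Finset.univ.filter (fun i => y i = true)).card =
      (Finset.univ.filter (fun i => x i = true)).card) :
    ∃ π : Equiv.Perm (Fin n), ∀ i, x (π i) = y i := by
  have hcard : Fintype.card {i // y i = true} = Fintype.card {i // x i = true} := by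
    rw [Fintype.card_subtype, Fintype.card_subtype, h]
  let e := Fintype.equivOfCardEq hcard
  refine ⟨e.extendSubtype, fun i => ?_⟩
  by_cases hi : y i = true
  · rw [hi, e.extendSubtype_mem i hi]
  · have := e.extendSubtype_not_mem i hi
    rw [Bool.not_eq_true] at hi this
    rw [hi, this]

lemma card_filter_card_true (n m : ℕ) :
    (Finset.univ.filter (fun x : Fin n → Bool =>
      (Finset.univ.filter (fun i => x i = true)).card = m)).card = n.choose m := by
  have h : (Finset.powersetCard m (Finset.univ : Finset (Fin n))).card = n.choose m := by
    rw [Finset.card_powersetCard, Finset.card_univ, Fintype.card_fin]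
  rw [← h]
  refine Finset.card_bij' (fun x _ => Finset.univ.filter (fun i => x i = true))
    (fun s _ => fun i => decide (i ∈ s)) ?_ ?_ ?_ ?_
  · intro x hx
    simpa [Finset.mem_powersetCard] using hx
  · intro s hs
    simpa [Finset.mem_powersetCard] using hs
  · intro x _
    simp
  · intro s _
    simp

/-- Here `σ i` is the rank, from `0`, at which component `i` fails; `k ≤ σ i` says that `i` survives
the first `k` failures. -/
lemma card_filter_le_perm (σ : Equiv.Perm (Fin n)) (k : ℕ) :
    (Finset.univ.filter (fun i => decide (k ≤ (σ i : ℕ)) = true)).card = n - k := by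
  simp only [decide_eq_true_eq]
  have h : (Finset.univ.filter (fun i => k ≤ (σ i : ℕ))).card =
      (Finset.univ.filter (fun i : Fin n => k ≤ (i : ℕ))).card :=
    Finset.card_equiv σ (by simp)
  rw [h]
  have h2 : (Finset.univ.filter (fun i : Fin n => k ≤ (i : ℕ))).card =
      ((Finset.Ico k n)).card := by
    refine Finset.card_bij (fun i _ => (i : ℕ)) (fun i hi => ?_) (fun i _ l _ h => Fin.ext h) ?_
    · simpa using hi
    · intro b hb
      rw [Finset.mem_Ico] at hb
      exact ⟨⟨b, hb.2⟩, by simpa using hb.1, rfl⟩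
  rw [h2, Nat.card_Ico]

/-- All states with the same number of working components arise from equally many permutations. -/
lemma card_perm_eq_state (k : ℕ) (x : Fin n → Bool)
    (hx : (Finset.univ.filter (fun i => x i = true)).card = n - k) :
    ((Finset.univ.filter (fun σ : Equiv.Perm (Fin n) =>
      (fun i => decide (k ≤ (σ i : ℕ))) = x)).card : ℝ) = n.factorial / n.choose (n - k) := by
  set c : (Fin n → Bool) → ℕ := fun x => (Finset.univ.filter (fun σ : Equiv.Perm (Fin n) =>
      (fun i => decide (k ≤ (σ i : ℕ))) = x)).card with hc
  have hconst : ∀ y ∈ Finset.univ.filter (fun y : Fin n → Bool =>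
      (Finset.univ.filter (fun i => y i = true)).card = n - k), c y = c x := by
    intro y hy
    rw [Finset.mem_filter] at hy
    obtain ⟨π, hπ⟩ := exists_perm_comp_eq (x := y) (y := x) (hx.trans hy.2.symm)
    -- Composition on the right with `π`, which carries `x` to `y`, is a bijection from the orders
    -- producing `y` to those producing `x`.
    refine Finset.card_equiv (Equiv.mulRight π) fun σ => ?_
    simp only [Finset.mem_filter, Finset.mem_univ, true_and, funext_iff]
    constructor
    · exact fun h i => (h (π i)).trans (hπ i)
    · intro h i
      have h2 : ∀ a, decide (k ≤ (σ (π a) : ℕ)) = y (π a) := fun a => (h a).trans (hπ a).symm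
      simpa using h2 (π.symm i)
  have hsum : ∑ y ∈ Finset.univ.filter (fun y : Fin n → Bool =>
      (Finset.univ.filter (fun i => y i = true)).card = n - k), c y = n.factorial := by
    rw [hc, ← Finset.card_eq_sum_card_fiberwise, Finset.card_univ, Fintype.card_perm,
      Fintype.card_fin]
    intro σ _
    simpa using card_filter_le_perm σ k
  rw [Finset.sum_congr rfl hconst, Finset.sum_const, card_filter_card_true, smul_eq_mul] at hsum
  have hpos : (0 : ℝ) < n.choose (n - k) := by
    exact_mod_cast Nat.choose_pos (Nat.sub_le n k)
  rw [eq_div_iff hpos.ne', mul_comm]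
  exact_mod_cast hsum

/-- The state after `k` failures in a uniformly random order is uniform among the states with `k`
failures. -/
lemma sum_perm_working (Φ : (Fin n → Bool) → Bool) (k : ℕ) :
    ∑ σ : Equiv.Perm (Fin n), (if Φ (fun i => decide (k ≤ (σ i : ℕ))) = true then (1 : ℝ) else 0) =
      n.factorial * survivalProportion Φ k := by
  have h1 : ∀ σ ∈ (Finset.univ : Finset (Equiv.Perm (Fin n))),
      (fun i => decide (k ≤ (σ i : ℕ))) ∈ Finset.univ.filter (fun y : Fin n → Bool =>
      (Finset.univ.filter (fun i => y i = true)).card = n - k) := by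
    intro σ _
    simpa using card_filter_le_perm σ k
  rw [← Finset.sum_fiberwise_of_maps_to h1, survivalProportion, ← mul_assoc, Finset.mul_sum]
  refine Finset.sum_congr rfl fun x hx => ?_
  rw [Finset.mem_filter] at hx
  have h2 : ∀ σ ∈ Finset.univ.filter (fun σ : Equiv.Perm (Fin n) =>
      (fun i => decide (k ≤ (σ i : ℕ))) = x),
      (if Φ (fun i => decide (k ≤ (σ i : ℕ))) = true then (1 : ℝ) else 0) =
        if Φ x = true then (1 : ℝ) else 0 := by
    intro σ hσ
    rw [(Finset.mem_filter.1 hσ).2]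
  rw [Finset.sum_congr rfl h2, Finset.sum_const, nsmul_eq_mul, card_perm_eq_state k x hx.2]
  ring

/-- The first time at which the system with component lifetimes `T` is in a failed state. -/
noncomputable def failureTimeOf (Φ : (Fin n → Bool) → Bool) (T : Fin n → ℝ≥0∞) : ℝ≥0∞ :=
  ⨅ (t : ℝ≥0) (_ : Φ (fun i => decide ((t : ℝ≥0∞) < T i)) = false), (t : ℝ≥0∞)

/-- If components fail in the order given by `σ`, the system fails at the order statistic whose
index is the least number of failures that brings down the system. -/
lemma exists_failureTimeOf_eq {Φ : (Fin n → Bool) → Bool} (hΦ : IsSemiCoherent Φ)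
    (T : Fin n → ℝ≥0∞) (σ : Equiv.Perm (Fin n)) :
    ∃ κ, 1 ≤ κ ∧ κ ≤ n ∧
      (∀ k, Φ (fun i => decide (k ≤ (σ i : ℕ))) = true ↔ k < κ) ∧
      failureTimeOf Φ (fun i => T (Tuple.sort T (σ i))) = orderStatistic T κ ∧
      ∀ t, Φ (fun i => decide (t < T (Tuple.sort T (σ i)))) = false ↔
        failureTimeOf Φ (fun i => T (Tuple.sort T (σ i))) ≤ t := by
  have hanti : ∀ k l, k ≤ l → Φ (fun i => decide (l ≤ (σ i : ℕ))) = true →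
      Φ (fun i => decide (k ≤ (σ i : ℕ))) = true := by
    intro k l hkl h
    have h2 : Φ (fun i => decide (l ≤ (σ i : ℕ))) ≤ Φ (fun i => decide (k ≤ (σ i : ℕ))) := by
      apply hΦ.monotone
      intro i
      simp only [Bool.le_iff_imp, decide_eq_true_eq]
      exact fun h => hkl.trans h
    exact Bool.le_iff_imp.1 h2 h
  have hex : ∃ k, Φ (fun i => decide (k ≤ (σ i : ℕ))) = false := by
    refine ⟨n, ?_⟩
    rw [← hΦ.all_failed]
    congr 1
    funext i
    simp
  have hfind : Φ (fun i => decide (n ≤ (σ i : ℕ))) = false := by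
    rw [← hΦ.all_failed]
    congr 1
    funext i
    simp
  have hle : Nat.find hex ≤ n := Nat.find_min' hex hfind
  have hpos : 1 ≤ Nat.find hex := by
    rw [Nat.one_le_iff_ne_zero]
    intro h
    have h2 := Nat.find_spec hex
    rw [h] at h2
    simp [hΦ.all_working] at h2
  have hiff : ∀ k, Φ (fun i => decide (k ≤ (σ i : ℕ))) = true ↔ k < Nat.find hex := by
    intro k
    constructor
    · intro h
      by_contra! hk
      have := hanti _ _ hk h
      rw [Nat.find_spec hex] at this
      exact absurd this (by decide)
    · intro h
      simpa using Nat.find_min hex h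
  refine ⟨Nat.find hex, hpos, hle, hiff, ?_⟩
  have hstate : ∀ t : ℝ≥0∞, (fun i => decide (t < T (Tuple.sort T (σ i)))) =
      fun i => decide (elapsedCount T t ≤ (σ i : ℕ)) := by
    intro t
    funext i
    rw [decide_eq_decide]
    -- The component of rank `σ i`, counted from `0`, has lifetime `T_{σ i + 1:n}`; it works at `t`
    -- iff at most `σ i` lifetimes have elapsed.
    have := elapsedCount_lt_iff (T := T) (k := (σ i : ℕ) + 1) (by omega) (by omega) t
    rw [orderStatistic, dif_pos (by simp)] at this
    simp only [Nat.add_sub_cancel, Fin.eta] at this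
    rw [← this]
    omega
  have hcond : ∀ t : ℝ≥0∞, Φ (fun i => decide (t < T (Tuple.sort T (σ i)))) = false ↔
      orderStatistic T (Nat.find hex) ≤ t := by
    intro t
    rw [hstate, ← le_elapsedCount_iff hpos hle, ← Bool.not_eq_true, hiff, not_lt]
  unfold failureTimeOf
  have hinf : (⨅ (t : ℝ≥0) (_ : Φ (fun i => decide ((t : ℝ≥0∞) < T (Tuple.sort T (σ i)))) = false),
      (t : ℝ≥0∞)) = orderStatistic T (Nat.find hex) := by
    apply le_antisymm
    · by_cases hat : orderStatistic T (Nat.find hex) = ⊤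
      · exact hat ▸ le_top
      have h1 := ENNReal.coe_toNNReal hat
      refine (iInf₂_le (orderStatistic T (Nat.find hex)).toNNReal ?_).trans h1.le
      rw [hcond, h1]
    · exact le_iInf₂ fun t ht => (hcond t).1 ht
  exact ⟨hinf, fun t => by rw [hcond, hinf]⟩

lemma failureTimeOf_le_iff {Φ : (Fin n → Bool) → Bool} (hΦ : IsSemiCoherent Φ)
    (T : Fin n → ℝ≥0∞) (t : ℝ≥0∞) :
    failureTimeOf Φ T ≤ t ↔ Φ (fun i => decide (t < T i)) = false := by
  -- The inverse of the sorting permutation undoes the sorting, so the relabelled vector is `T`.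
  obtain ⟨κ, -, -, -, -, h⟩ := exists_failureTimeOf_eq hΦ T (Tuple.sort T)⁻¹
  simpa using (h t).symm

/-- Averaging over all relabellings of the components, the law of the count at system failure is
the signature mixture of the counts at the order statistics. -/
lemma sum_perm_elapsedCount_failureTimeOf {Φ : (Fin n → Bool) → Bool} (hΦ : IsSemiCoherent Φ)
    (T : Fin n → ℝ≥0∞) (j : ℕ) :
    ∑ σ : Equiv.Perm (Fin n),
      (if elapsedCount T (failureTimeOf Φ (fun i => T (σ i))) = j then (1 : ℝ) else 0) =
    n.factorial * ∑ k ∈ Finset.Icc 1 n, structuralSignature Φ k *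
      (if elapsedCount T (orderStatistic T k) = j then (1 : ℝ) else 0) := by
  -- Reindexing by the sorting permutation makes `σ i` the rank of component `i`.
  refine (Equiv.sum_comp (Equiv.mulLeft (Tuple.sort T)) _).symm.trans ?_
  have h1 : ∀ σ : Equiv.Perm (Fin n),
      (if elapsedCount T (failureTimeOf Φ (fun i => T (Tuple.sort T (σ i)))) = j
        then (1 : ℝ) else 0) =
      ∑ k ∈ Finset.Icc 1 n,
        ((if Φ (fun i => decide (k - 1 ≤ (σ i : ℕ))) = true then (1 : ℝ) else 0) -
          (if Φ (fun i => decide (k ≤ (σ i : ℕ))) = true then (1 : ℝ) else 0)) *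
        (if elapsedCount T (orderStatistic T k) = j then (1 : ℝ) else 0) := by
    intro σ
    obtain ⟨κ, h1, h2, h3, h4, -⟩ := exists_failureTimeOf_eq hΦ T σ
    rw [h4, Finset.sum_eq_single_of_mem κ (Finset.mem_Icc.2 ⟨h1, h2⟩)]
    -- The difference of indicators is `1` at `k = κ` and `0` elsewhere: the system survives `κ - 1`
    -- failures but not `κ`.
    · rw [if_pos ((h3 (κ - 1)).2 (by omega)), if_neg (fun h => absurd ((h3 κ).1 h) (by omega))]
      simp
    · intro k hk hne
      rw [Finset.mem_Icc] at hk
      have : (if Φ (fun i => decide (k - 1 ≤ (σ i : ℕ))) = true then (1 : ℝ) else 0) =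
          (if Φ (fun i => decide (k ≤ (σ i : ℕ))) = true then (1 : ℝ) else 0) := by
        simp only [h3]
        exact if_congr (by omega) rfl rfl
      rw [this, sub_self, zero_mul]
  refine (Finset.sum_congr rfl fun σ _ => h1 σ).trans ?_
  rw [Finset.sum_comm, Finset.mul_sum]
  refine Finset.sum_congr rfl fun k _ => ?_
  rw [← Finset.sum_mul, Finset.sum_sub_distrib, sum_perm_working Φ (k - 1),
    sum_perm_working Φ k, structuralSignature]
  ring

end Signature

/-! ### First passage times of nondecreasing paths -/

section Passage

open Filter Topology

/-- The first passage time above `e` along the rational times. -/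
noncomputable def rationalPassage (f : ℝ≥0 → ℝ) (e : ℝ) : ℝ≥0∞ :=
  ⨅ (q : ℚ) (_ : e < f (q : ℝ).toNNReal), ((q : ℝ).toNNReal : ℝ≥0∞)

/-- A countable infimum is measurable in the path for the product σ-algebra, which the infimum over
all times is not visibly. -/
lemma iInf_passage_eq_rationalPassage {f : ℝ≥0 → ℝ} (hf : Monotone f) (e : ℝ) :
    (⨅ (t : ℝ≥0) (_ : e < f t), (t : ℝ≥0∞)) = rationalPassage f e := by
  apply le_antisymm
  · exact le_iInf₂ fun q hq => iInf₂_le (q : ℝ).toNNReal hq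
  · refine le_iInf₂ fun t ht => ?_
    by_contra! h
    obtain ⟨q, -, h1, h2⟩ := ENNReal.lt_iff_exists_rat_btwn.1 h
    refine absurd h2 (not_lt.2 (iInf₂_le q (ht.trans_le (hf ?_))))
    exact (ENNReal.coe_lt_coe.1 h1).le

/-- Passage strictly above `e` by time `t` gives only `e ≤ f t`, by right-continuity. Conversely, `e
≤ f t` forces `e < f q` at each rational `q > t`, as equality is excluded there. -/
lemma iInf_passage_le_iff {f : ℝ≥0 → ℝ} (hf : Monotone f)
    (hc : ∀ t, ContinuousWithinAt f (Ici t) t) {e : ℝ} (he : ∀ q : ℚ, f (q : ℝ).toNNReal ≠ e)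
    (t : ℝ≥0) : (⨅ (t : ℝ≥0) (_ : e < f t), (t : ℝ≥0∞)) ≤ t ↔ e ≤ f t := by
  constructor
  · intro h
    have hlim : Tendsto f (𝓝[>] t) (𝓝 (f t)) := (hc t).mono_left (nhdsWithin_mono _ Ioi_subset_Ici_self)
    refine ge_of_tendsto hlim ?_
    filter_upwards [self_mem_nhdsWithin] with u hu
    have h2 : (⨅ (t : ℝ≥0) (_ : e < f t), (t : ℝ≥0∞)) < u :=
      h.trans_lt (ENNReal.coe_lt_coe.2 hu)
    simp only [iInf_lt_iff] at h2
    obtain ⟨s, hs, hsu⟩ := h2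
    exact hs.le.trans (hf (ENNReal.coe_lt_coe.1 hsu).le)
  · intro h
    by_contra! hlt
    obtain ⟨q, -, h1, h2⟩ := ENNReal.lt_iff_exists_rat_btwn.1 hlt
    have h3 : e < f (q : ℝ).toNNReal :=
      lt_of_le_of_ne (h.trans (hf (ENNReal.coe_lt_coe.1 h1).le)) (he q).symm
    exact absurd h2 (not_lt.2 (iInf₂_le (q : ℝ).toNNReal h3))

end Passage

/-! ### Measurability -/

section Measurability

variable {n : ℕ}

lemma measurable_rationalPassage :
    Measurable (fun p : (ℝ≥0 → ℝ) × ℝ => rationalPassage p.1 p.2) := by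
  unfold rationalPassage
  refine Measurable.iInf fun q => ?_
  have h : (fun p : (ℝ≥0 → ℝ) × ℝ => ⨅ (_ : p.2 < p.1 (q : ℝ).toNNReal),
      ((q : ℝ).toNNReal : ℝ≥0∞)) = fun p => if p.2 < p.1 (q : ℝ).toNNReal then
        ((q : ℝ).toNNReal : ℝ≥0∞) else ⊤ := by
    funext p
    by_cases h : p.2 < p.1 (q : ℝ).toNNReal <;> simp [h]
  rw [h]
  refine Measurable.ite (measurableSet_lt measurable_snd ?_) measurable_const measurable_const
  exact (measurable_pi_apply _).comp measurable_fst

lemma measurable_elapsedCount {α : Type*} [MeasurableSpace α] {T : α → Fin n → ℝ≥0∞}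
    {g : α → ℝ≥0∞} (hT : Measurable T) (hg : Measurable g) :
    Measurable (fun a => elapsedCount (T a) (g a)) := by
  simp only [elapsedCount, Finset.card_filter]
  refine Finset.measurable_sum _ fun i _ => ?_
  exact Measurable.ite (measurableSet_le ((measurable_pi_apply i).comp hT) hg)
    measurable_const measurable_const

lemma measurable_orderStatistic {k : ℕ} (hk : 1 ≤ k) (hkn : k ≤ n) :
    Measurable (fun T : Fin n → ℝ≥0∞ => orderStatistic T k) := by
  refine measurable_of_Iic fun y => ?_
  have h : (fun T : Fin n → ℝ≥0∞ => orderStatistic T k) ⁻¹' Iic y =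
      {T | k ≤ elapsedCount T y} := by
    ext T
    simp [le_elapsedCount_iff hk hkn]
  rw [h]
  exact measurableSet_le measurable_const (measurable_elapsedCount measurable_id measurable_const)

lemma measurable_failureTimeOf {Φ : (Fin n → Bool) → Bool} (hΦ : IsSemiCoherent Φ) :
    Measurable (failureTimeOf Φ) := by
  refine measurable_of_Iic fun y => ?_
  have h : failureTimeOf Φ ⁻¹' Iic y =
      (fun T : Fin n → ℝ≥0∞ => fun i => decide (y < T i)) ⁻¹' (Φ ⁻¹' {false}) := by
    ext T
    simp [failureTimeOf_le_iff hΦ]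
  rw [h]
  refine (measurable_pi_iff.2 fun i => ?_) (Set.toFinite _).measurableSet
  refine measurable_to_bool ?_
  have : (fun T : Fin n → ℝ≥0∞ => decide (y < T i)) ⁻¹' {true} = {T | y < T i} := by
    ext T
    simp
  rw [this]
  exact measurableSet_lt measurable_const (measurable_pi_apply i)

end Measurability

/-! ### Exponential triggers -/

section Exponential

instance : IsProbabilityMeasure (expMeasure 1) := isProbabilityMeasure_expMeasure one_pos

lemma expMeasure_singleton (a : ℝ) : expMeasure 1 {a} = 0 := by
  have h : expMeasure 1 ≪ volume := withDensity_absolutelyContinuous _ _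
  exact h (measure_singleton a)

lemma expMeasure_real_Iic {a : ℝ} (ha : 0 ≤ a) :
    (expMeasure 1).real (Iic a) = 1 - Real.exp (-a) := by
  rw [← cdf_eq_real, cdf_expMeasure_eq one_pos, if_pos ha, one_mul]

lemma expMeasure_real_Ioi {a : ℝ} (ha : 0 ≤ a) :
    (expMeasure 1).real (Ioi a) = Real.exp (-a) := by
  rw [← compl_Iic, probReal_compl_eq_one_sub measurableSet_Iic, expMeasure_real_Iic ha]
  ring

lemma expMeasure_real_Ioc {a b : ℝ} (ha : 0 ≤ a) (hab : a ≤ b) :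
    (expMeasure 1).real (Ioc a b) = Real.exp (-a) - Real.exp (-b) := by
  have h : Ioc a b = Iic b \ Iic a := by
    ext x
    simp [and_comm]
  rw [h, measureReal_sdiff (Iic_subset_Iic.2 hab) measurableSet_Iic,
    expMeasure_real_Iic ha, expMeasure_real_Iic (ha.trans hab)]
  ring

/-- Fubini: conditioning on `X` freezes it and leaves the law of `Y`. -/
lemma measure_indepFun_preimage {Ω α β : Type*} [MeasurableSpace Ω] [MeasurableSpace α]
    [MeasurableSpace β] {P : Measure Ω} [IsProbabilityMeasure P] {X : Ω → α} {Y : Ω → β}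
    {ν : Measure β} [IsProbabilityMeasure ν] (hX : Measurable X) (hY : Measurable Y)
    (hν : P.map Y = ν) (hXY : IndepFun X Y P) {S : Set (α × β)} (hS : MeasurableSet S) :
    P {ω | (X ω, Y ω) ∈ S} = ∫⁻ ω, ν (Prod.mk (X ω) ⁻¹' S) ∂P := by
  have h := (indepFun_iff_map_prod_eq_prod_map_map hX.aemeasurable hY.aemeasurable).1 hXY
  have h2 : P {ω | (X ω, Y ω) ∈ S} = (P.map fun ω => (X ω, Y ω)) S :=
    (Measure.map_apply (hX.prodMk hY) hS).symm
  rw [h2, h, hν, Measure.prod_apply hS, lintegral_map (measurable_measure_prodMk_left hS) hX]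

end Exponential

/-! ### Laws of the ingredients of the model. -/

section Model

variable {Ω : Type*} [MeasurableSpace Ω] {P : Measure Ω} {n : ℕ}
  {L : ℝ≥0 → Ω → ℝ} {ε : Fin n → Ω → ℝ}

lemma IsLevySubordinator.measurable_path (h : IsLevySubordinator L P) :
    Measurable (fun ω t => L t ω) := measurable_pi_iff.2 h.measurable

lemma IsLFMOModel.measurable_triggers (h : IsLFMOModel L ε P) :
    Measurable (fun ω i => ε i ω) := measurable_pi_iff.2 h.measurable_trigger

lemma IsLFMOModel.map_triggers [IsProbabilityMeasure P] (h : IsLFMOModel L ε P) :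
    P.map (fun ω i => ε i ω) = Measure.pi fun _ => expMeasure 1 := by
  rw [(iIndepFun_iff_map_fun_eq_pi_map fun i => (h.measurable_trigger i).aemeasurable).1
    h.iIndep_trigger]
  congr 1
  funext i
  exact (h.trigger_law i).map_eq

lemma IsLFMOModel.measure_trigger_preimage [IsProbabilityMeasure P]
    (h : IsLFMOModel L ε P) (t : ℝ≥0) (i : Fin n)
    {S : Set (ℝ × ℝ)} (hS : MeasurableSet S) :
    P {ω | (L t ω, ε i ω) ∈ S} = ∫⁻ ω, expMeasure 1 (Prod.mk (L t ω) ⁻¹' S) ∂P := by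
  refine measure_indepFun_preimage (h.subordinator.measurable t) (h.measurable_trigger i)
    (h.trigger_law i).map_eq ?_ hS
  exact h.indep.comp (measurable_pi_apply t) (measurable_pi_apply i)

lemma IsLevySubordinator.ae_nonneg (h : IsLevySubordinator L P) :
    ∀ᵐ ω ∂P, ∀ t, 0 ≤ L t ω := by
  filter_upwards [h.zero, h.monotone] with ω h0 hm t
  rw [← h0]
  exact hm (zero_le : 0 ≤ t)

/-! ### The Laplace transform of the subordinator -/

lemma IsLevySubordinator.integrable_exp [IsProbabilityMeasure P]
    (h : IsLevySubordinator L P) {x : ℝ} (hx : 0 ≤ x)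
    (t : ℝ≥0) : Integrable (fun ω => Real.exp (-(x * L t ω))) P := by
  refine Integrable.of_bound (C := 1) ?_ ?_
  · exact (((h.measurable t).const_mul x).neg.exp).aestronglyMeasurable
  · filter_upwards [h.ae_nonneg] with ω hω
    rw [Real.norm_of_nonneg (Real.exp_nonneg _), Real.exp_le_one_iff]
    have := mul_nonneg hx (hω t)
    linarith

lemma IsLevySubordinator.identDistrib_increment (h : IsLevySubordinator L P) (s t : ℝ≥0) :
    IdentDistrib (fun ω => L (s + t) ω - L s ω) (L t) P P := by
  refine (h.stationary_increments s t).trans (IdentDistrib.of_ae_eq ?_ ?_)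
  · exact ((h.measurable t).sub (h.measurable 0)).aemeasurable
  · filter_upwards [h.zero] with ω h0
    simp [h0]

lemma IsLevySubordinator.indepFun_increment (h : IsLevySubordinator L P) (s t : ℝ≥0) :
    IndepFun (L s) (fun ω => L (s + t) ω - L s ω) P :=
  h.indep_increments.indepFun_eval_sub zero_le le_self_add h.zero

lemma IsLevySubordinator.integral_exp_add [IsProbabilityMeasure P]
    (h : IsLevySubordinator L P) (x : ℝ) (s t : ℝ≥0) :
    ∫ ω, Real.exp (-(x * L (s + t) ω)) ∂P =
      (∫ ω, Real.exp (-(x * L s ω)) ∂P) * ∫ ω, Real.exp (-(x * L t ω)) ∂P := by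
  have hm : Measurable fun y : ℝ => Real.exp (-(x * y)) := by fun_prop
  have h1 := (h.indepFun_increment s t).integral_comp_mul_comp (𝕜 := ℝ)
    (h.measurable s).aemeasurable ((h.measurable (s + t)).sub (h.measurable s)).aemeasurable
    hm.aestronglyMeasurable hm.aestronglyMeasurable
  have h2 := ((h.identDistrib_increment s t).comp hm).integral_eq
  simp only [Function.comp_apply, Pi.mul_apply] at h1 h2
  rw [← h2]
  refine Eq.trans ?_ h1
  refine integral_congr_ae (Filter.Eventually.of_forall fun ω => ?_)
  dsimp only
  rw [← Real.exp_add]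
  congr 1
  ring

lemma IsLevySubordinator.integral_exp_nat_mul [IsProbabilityMeasure P]
    (h : IsLevySubordinator L P) (x : ℝ) (t : ℝ≥0)
    (m : ℕ) : ∫ ω, Real.exp (-(x * L (m * t) ω)) ∂P =
      (∫ ω, Real.exp (-(x * L t ω)) ∂P) ^ m := by
  induction m with
  | zero =>
    have : ∀ᵐ ω ∂P, Real.exp (-(x * L ((0 : ℕ) * t) ω)) = 1 := by
      filter_upwards [h.zero] with ω h0
      simp [h0]
    rw [integral_congr_ae this]
    simp
  | succ m ih =>
    rw [pow_succ, ← ih, ← h.integral_exp_add]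
    congr 2
    push_cast
    rw [add_mul, one_mul]

lemma IsLevySubordinator.integral_exp_pos [IsProbabilityMeasure P]
    (h : IsLevySubordinator L P) {x : ℝ} (hx : 0 ≤ x)
    (t : ℝ≥0) : 0 < ∫ ω, Real.exp (-(x * L t ω)) ∂P := by
  exact MeasureTheory.integral_exp_pos (h.integrable_exp hx t)

lemma IsLevySubordinator.integral_exp_one [IsProbabilityMeasure P]
    (h : IsLevySubordinator L P) {x : ℝ} (hx : 0 ≤ x) :
    ∫ ω, Real.exp (-(x * L 1 ω)) ∂P = Real.exp (-laplaceExponent L P x) := by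
  rw [laplaceExponent, neg_neg, Real.exp_log (h.integral_exp_pos hx 1)]

/-- Extraction of an `(N + 1)`-st root in the multiplicative relation; times `1/(N + 1)` suffice for
the grids, so continuity in time is not needed. -/
lemma IsLevySubordinator.integral_exp_inv [IsProbabilityMeasure P]
    (h : IsLevySubordinator L P) {x : ℝ} (hx : 0 ≤ x)
    (N : ℕ) : ∫ ω, Real.exp (-(x * L ((N : ℝ≥0) + 1)⁻¹ ω)) ∂P =
      Real.exp (-(laplaceExponent L P x * ((N : ℝ) + 1)⁻¹)) := by
  have h1 := h.integral_exp_nat_mul x ((N : ℝ≥0) + 1)⁻¹ (N + 1)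
  have h2 : ((N + 1 : ℕ) : ℝ≥0) * ((N : ℝ≥0) + 1)⁻¹ = 1 := by
    push_cast
    exact mul_inv_cancel₀ (by positivity)
  rw [h2, h.integral_exp_one hx] at h1
  have hN : (0 : ℝ) < N + 1 := by positivity
  refine (pow_left_inj₀ (h.integral_exp_pos hx _).le (Real.exp_nonneg _) N.succ_ne_zero).1 ?_
  rw [Nat.succ_eq_add_one, ← h1, ← Real.exp_nat_mul]
  congr 1
  push_cast
  field_simp

lemma IsLevySubordinator.integral_exp_one_lt [IsProbabilityMeasure P] (h : IsLevySubordinator L P)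
    (hL : ¬ (∀ᵐ ω ∂P, L 1 ω = 0)) {x : ℝ} (hx : 0 < x) :
    ∫ ω, Real.exp (-(x * L 1 ω)) ∂P < 1 := by
  by_contra! hcon
  refine hL ?_
  have h1 : 0 ≤ᵐ[P] fun ω => 1 - Real.exp (-(x * L 1 ω)) := by
    filter_upwards [h.ae_nonneg] with ω hω
    have := mul_nonneg hx.le (hω 1)
    simp only [Pi.zero_apply, sub_nonneg, Real.exp_le_one_iff]
    linarith
  have h2 : Integrable (fun ω => 1 - Real.exp (-(x * L 1 ω))) P :=
    (integrable_const _).sub (h.integrable_exp hx.le 1)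
  have h3 : ∫ ω, (1 - Real.exp (-(x * L 1 ω))) ∂P = 0 := by
    refine le_antisymm ?_ (integral_nonneg_of_ae h1)
    rw [integral_sub (integrable_const _) (h.integrable_exp hx.le 1)]
    simpa using hcon
  filter_upwards [(integral_eq_zero_iff_of_nonneg_ae h1 h2).1 h3] with ω hω
  have h4 : Real.exp (-(x * L 1 ω)) = 1 := by
    simp only [Pi.zero_apply] at hω
    linarith
  rw [Real.exp_eq_one_iff] at h4
  have h5 : x * L 1 ω = 0 := by linarith
  exact (mul_eq_zero.1 h5).resolve_left hx.ne'

lemma IsLevySubordinator.laplaceExponent_pos [IsProbabilityMeasure P] (h : IsLevySubordinator L P)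
    (hL : ¬ (∀ᵐ ω ∂P, L 1 ω = 0)) {x : ℝ} (hx : 0 < x) : 0 < laplaceExponent L P x :=
  neg_pos.2 (Real.log_neg (h.integral_exp_pos hx.le 1) (h.integral_exp_one_lt hL hx))

/-! ### Almost sure properties of the lifetimes -/

lemma IsLFMOModel.ae_trigger_pos (h : IsLFMOModel L ε P) : ∀ᵐ ω ∂P, ∀ i, 0 < ε i ω := by
  rw [ae_all_iff]
  intro i
  have h1 : P.map (ε i) (Iic 0) = 0 := by
    rw [(h.trigger_law i).map_eq, ← measureReal_eq_zero_iff, expMeasure_real_Iic le_rfl]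
    simp
  rw [Measure.map_apply (h.measurable_trigger i) measurableSet_Iic] at h1
  rw [ae_iff]
  refine measure_mono_null (fun ω hω => ?_) h1
  simpa using hω

lemma IsLFMOModel.ae_ne_trigger [IsProbabilityMeasure P] (h : IsLFMOModel L ε P) :
    ∀ᵐ ω ∂P, ∀ i, ∀ q : ℚ, L (q : ℝ).toNNReal ω ≠ ε i ω := by
  rw [ae_all_iff]
  intro i
  rw [ae_all_iff]
  intro q
  rw [ae_iff]
  have h1 := h.measure_trigger_preimage (q : ℝ).toNNReal i
    (measurableSet_eq_fun (f := fun p : ℝ × ℝ => p.1) measurable_fst measurable_snd)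
  simp only [ne_eq, not_not, mem_ofPred_eq, preimage_ofPred_eq] at h1 ⊢
  rw [h1]
  simp [expMeasure_singleton]

/-- The probability of surviving to time `m` is `E[exp (-L_m)] = (E[exp (-L_1)])^m`, which tends to
`0` since `L` is nontrivial. -/
lemma IsLFMOModel.ae_exists_trigger_le [IsProbabilityMeasure P]
    (h : IsLFMOModel L ε P) (hL : ¬ (∀ᵐ ω ∂P, L 1 ω = 0)) :
    ∀ᵐ ω ∂P, ∀ i, ∃ m : ℕ, ε i ω ≤ L m ω := by
  rw [ae_all_iff]
  intro i
  have h1 : ∀ m : ℕ, P.real {ω | L m ω < ε i ω} = (∫ ω, Real.exp (-(1 * L 1 ω)) ∂P) ^ m := by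
    intro m
    have h2 := h.measure_trigger_preimage m i
      (measurableSet_lt (f := fun p : ℝ × ℝ => p.1) measurable_fst measurable_snd)
    simp only [mem_ofPred_eq, preimage_ofPred_eq] at h2
    rw [measureReal_def, h2, ← h.subordinator.integral_exp_nat_mul, mul_one,
      integral_eq_lintegral_of_nonneg_ae (Filter.Eventually.of_forall fun _ => Real.exp_nonneg _)
      (h.subordinator.integrable_exp zero_le_one m).aestronglyMeasurable]
    congr 1
    refine lintegral_congr_ae ?_
    filter_upwards [h.subordinator.ae_nonneg] with ω hω
    rw [one_mul, ← expMeasure_real_Ioi (hω m), ofReal_measureReal]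
    rfl
  have h2 : Filter.Tendsto (fun m : ℕ => P.real {ω | L m ω < ε i ω}) Filter.atTop (nhds 0) := by
    simp only [h1]
    exact tendsto_pow_atTop_nhds_zero_of_lt_one
      (h.subordinator.integral_exp_pos zero_le_one 1).le
      (h.subordinator.integral_exp_one_lt hL one_pos)
  have h3 : P.real {ω | ¬ ∃ m : ℕ, ε i ω ≤ L m ω} ≤ 0 := by
    refine ge_of_tendsto' h2 fun m => measureReal_mono fun ω hω => ?_
    simp only [not_exists, not_le, mem_ofPred_eq] at hω ⊢
    exact hω m
  rw [ae_iff, ← measureReal_eq_zero_iff]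
  exact le_antisymm h3 measureReal_nonneg

lemma IsLFMOModel.ae_lifetime [IsProbabilityMeasure P]
    (h : IsLFMOModel L ε P) (hL : ¬ (∀ᵐ ω ∂P, L 1 ω = 0)) :
    ∀ᵐ ω ∂P, (∀ i, lifetime L ε i ω ≠ 0) ∧ (∀ i, lifetime L ε i ω ≠ ⊤) ∧
      (∀ i, ∀ t : ℝ≥0, lifetime L ε i ω ≤ t ↔ ε i ω ≤ L t ω) ∧
      (∀ i, lifetime L ε i ω = rationalPassage (fun t => L t ω) (ε i ω)) := by
  filter_upwards [h.ae_trigger_pos, h.ae_ne_trigger, h.ae_exists_trigger_le hL,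
    h.subordinator.zero, h.subordinator.monotone, h.subordinator.right_continuous]
    with ω hpos hne hex h0 hm hc
  have hiff : ∀ i, ∀ t : ℝ≥0, lifetime L ε i ω ≤ t ↔ ε i ω ≤ L t ω := fun i t =>
    iInf_passage_le_iff hm hc (hne i) t
  refine ⟨fun i hi => ?_, fun i => ?_, hiff, fun i => iInf_passage_eq_rationalPassage hm _⟩
  · have := (hiff i 0).1 (by simp [hi])
    rw [h0] at this
    exact absurd (hpos i) (not_lt.2 this)
  · obtain ⟨m, hm⟩ := hex i
    exact ne_top_of_le_ne_top ENNReal.coe_ne_top ((hiff i m).2 hm)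

end Model

/-! ### The failure counts at two times -/

section TwoTimes

variable {Ω : Type*} {n : ℕ} {L : ℝ≥0 → Ω → ℝ} {ε : Fin n → Ω → ℝ}

/-- The set of components that have failed by time `t`. -/
noncomputable def failedSet (L : ℝ≥0 → Ω → ℝ) (ε : Fin n → Ω → ℝ) (ω : Ω) (t : ℝ≥0) : Finset (Fin n) :=
  Finset.univ.filter (fun i => ε i ω ≤ L t ω)

lemma card_failedSet (ω : Ω) (t : ℝ≥0) :
    (failedSet L ε ω t).card = failureCount L ε ω t := rfl

lemma failedSet_eq_iff (ω : Ω) (t : ℝ≥0) (A : Finset (Fin n)) :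
    failedSet L ε ω t = A ↔ ∀ k, ε k ω ≤ L t ω ↔ k ∈ A := by
  simp [failedSet, Finset.ext_iff]

variable [MeasurableSpace Ω] {P : Measure Ω}

lemma IsLFMOModel.measurableSet_failedSet_eq (h : IsLFMOModel L ε P) (t : ℝ≥0)
    (A : Finset (Fin n)) : MeasurableSet {ω | failedSet L ε ω t = A} := by
  simp only [failedSet_eq_iff, ofPred_forall]
  refine MeasurableSet.iInter fun k => ?_
  have h1 := measurableSet_le (h.measurable_trigger k) (h.subordinator.measurable t)
  by_cases hk : k ∈ A
  · simpa [hk] using h1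
  · simpa [hk, compl_ofPred] using h1.compl

lemma IsLFMOModel.measurable_failureCount (h : IsLFMOModel L ε P) (t : ℝ≥0) :
    Measurable (fun ω => failureCount L ε ω t) := by
  simp only [failureCount, Finset.card_filter]
  refine Finset.measurable_sum _ fun i _ => ?_
  exact Measurable.ite (measurableSet_le (h.measurable_trigger i) (h.subordinator.measurable t))
    measurable_const measurable_const

lemma prod_ite_mem_ite_mem {A B : Finset (Fin n)} (hAB : A ⊆ B) (u v w : ℝ) :
    ∏ k : Fin n, (if k ∈ A then u else if k ∈ B then v else w) =
      u ^ A.card * v ^ (B.card - A.card) * w ^ (n - B.card) := by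
  rw [Finset.prod_ite, Finset.prod_ite, Finset.prod_const, Finset.prod_const, Finset.prod_const,
    ← mul_assoc]
  have h1 : Finset.univ.filter (fun k => k ∈ A) = A := by ext; simp
  have h2 : (Finset.univ.filter (fun k => k ∉ A)).filter (fun k => k ∈ B) = B \ A := by
    ext; simp [and_comm]
  have h3 : (Finset.univ.filter (fun k => k ∉ A)).filter (fun k => k ∉ B) = Bᶜ := by
    ext k
    simp only [Finset.mem_filter, Finset.mem_univ, true_and, Finset.mem_compl]
    exact ⟨fun h => h.2, fun h => ⟨fun h' => h (hAB h'), h⟩⟩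
  rw [h1, h2, h3, Finset.card_sdiff_of_subset hAB, Finset.card_compl, Fintype.card_fin]

/-- Given the path, the triggers independently fall below `L s`, between the two levels, or above `L
(s + t)`. The factor `exp (-L s)` common to all survivors at time `s` splits off, and what remains
depends only on the increment, which is independent of `L s` and distributed as `L t`. -/
lemma IsLFMOModel.measureReal_failedSet_pair [IsProbabilityMeasure P] (h : IsLFMOModel L ε P)
    (s t : ℝ≥0) {A B : Finset (Fin n)} (hAB : A ⊆ B) :
    P.real {ω | failedSet L ε ω s = A ∧ failedSet L ε ω (s + t) = B} =
      (∫ ω, (1 - Real.exp (-L s ω)) ^ A.card * Real.exp (-L s ω) ^ (n - A.card) ∂P) *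
      ∫ ω, (1 - Real.exp (-L t ω)) ^ (B.card - A.card) * Real.exp (-L t ω) ^ (n - B.card) ∂P := by
  set I : Fin n → ℝ × ℝ → Set ℝ := fun k x =>
    if k ∈ A then Iic x.1 else if k ∈ B then Ioc x.1 x.2 else Ioi x.2 with hI
  set S : Set ((ℝ × ℝ) × (Fin n → ℝ)) := {p | ∀ k, p.2 k ∈ I k p.1} with hS
  have hSm : MeasurableSet S := by
    rw [hS]
    simp only [ofPred_forall]
    refine MeasurableSet.iInter fun k => ?_
    have m1 : Measurable fun p : (ℝ × ℝ) × (Fin n → ℝ) => p.2 k := by fun_prop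
    have m2 : Measurable fun p : (ℝ × ℝ) × (Fin n → ℝ) => p.1.1 := by fun_prop
    have m3 : Measurable fun p : (ℝ × ℝ) × (Fin n → ℝ) => p.1.2 := by fun_prop
    simp only [hI]
    split_ifs
    · exact measurableSet_le m1 m2
    · exact (measurableSet_lt m2 m1).inter (measurableSet_le m1 m3)
    · exact measurableSet_lt m3 m1
  have hX : Measurable fun ω => (L s ω, L (s + t) ω) :=
    (h.subordinator.measurable s).prodMk (h.subordinator.measurable (s + t))
  have hind : IndepFun (fun ω => (L s ω, L (s + t) ω)) (fun ω i => ε i ω) P :=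
    h.indep.comp (φ := fun l : ℝ≥0 → ℝ => (l s, l (s + t)))
      ((measurable_pi_apply s).prodMk (measurable_pi_apply (s + t))) measurable_id
  have hae : P.real {ω | failedSet L ε ω s = A ∧ failedSet L ε ω (s + t) = B} =
      P.real {ω | ((L s ω, L (s + t) ω), fun i => ε i ω) ∈ S} := by
    apply measureReal_congr
    filter_upwards [h.subordinator.monotone] with ω hω
    have hle : L s ω ≤ L (s + t) ω := hω le_self_add
    refine propext ?_
    change (failedSet L ε ω s = A ∧ failedSet L ε ω (s + t) = B) ↔
      ∀ k, ε k ω ∈ I k (L s ω, L (s + t) ω)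
    rw [failedSet_eq_iff, failedSet_eq_iff, ← forall_and]
    refine forall_congr' fun k => ?_
    simp only [hI]
    by_cases hA : k ∈ A
    · simp only [hA, hAB hA, if_true, iff_true, mem_Iic]
      exact ⟨fun h => h.1, fun h => ⟨h, h.trans hle⟩⟩
    · by_cases hB : k ∈ B
      · simp [hA, hB]
      · simp only [hA, hB, if_false, iff_false, not_le, mem_Ioi]
        exact ⟨fun h => h.2, fun h => ⟨hle.trans_lt h, h⟩⟩
  have hprod := measure_indepFun_preimage hX h.measurable_triggers h.map_triggers hind hSm
  have hm1 : Measurable fun y : ℝ =>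
      (1 - Real.exp (-y)) ^ A.card * Real.exp (-y) ^ (n - A.card) := by fun_prop
  have hm2 : Measurable fun y : ℝ =>
      (1 - Real.exp (-y)) ^ (B.card - A.card) * Real.exp (-y) ^ (n - B.card) := by fun_prop
  have hL1 := h.subordinator.measurable s
  have hL2 : Measurable (fun ω => L (s + t) ω - L s ω) := (h.subordinator.measurable (s + t)).sub hL1
  have hsplit := (h.subordinator.indepFun_increment s t).integral_comp_mul_comp (𝕜 := ℝ)
    hL1.aemeasurable hL2.aemeasurable hm1.aestronglyMeasurable hm2.aestronglyMeasurable
  have hid := ((h.subordinator.identDistrib_increment s t).comp hm2).integral_eq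
  simp only [Function.comp_apply, Pi.mul_apply] at hsplit hid
  have hcardB : B.card ≤ n := (Finset.card_le_univ B).trans (by simp)
  have hcardAB := Finset.card_le_card hAB
  rw [← hid]
  refine Eq.trans ?_ hsplit
  rw [hae, measureReal_def, hprod]
  have hnn : ∀ᵐ ω ∂P, 0 ≤ L s ω ∧ 0 ≤ L (s + t) ω - L s ω := by
    filter_upwards [h.subordinator.monotone, h.subordinator.ae_nonneg] with ω h1 h2
    exact ⟨h2 s, sub_nonneg.2 (h1 le_self_add)⟩
  have hpos : ∀ a d : ℝ, 0 ≤ a → 0 ≤ d →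
      0 ≤ (1 - Real.exp (-a)) ^ A.card * Real.exp (-a) ^ (n - A.card) *
        ((1 - Real.exp (-d)) ^ (B.card - A.card) * Real.exp (-d) ^ (n - B.card)) := by
    intro a d ha hd
    have h1 : 0 ≤ 1 - Real.exp (-a) := by simpa using ha
    have h2 : 0 ≤ 1 - Real.exp (-d) := by simpa using hd
    positivity
  rw [integral_eq_lintegral_of_nonneg_ae]
  · congr 1
    refine lintegral_congr_ae ?_
    filter_upwards [hnn] with ω hω
    obtain ⟨ha, hd⟩ := hω
    set a := L s ω
    set b := L (s + t) ω
    have hsec : Prod.mk (a, b) ⁻¹' S = univ.pi fun k => I k (a, b) := by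
      ext e
      simp [hS]
    rw [hsec, Measure.pi_pi]
    have hI2 : ∀ k, expMeasure 1 (I k (a, b)) = ENNReal.ofReal (if k ∈ A then 1 - Real.exp (-a) else
        if k ∈ B then Real.exp (-a) - Real.exp (-b) else Real.exp (-b)) := by
      intro k
      simp only [hI]
      split_ifs
      · rw [← expMeasure_real_Iic ha, ofReal_measureReal]
      · rw [← expMeasure_real_Ioc ha (by linarith), ofReal_measureReal]
      · rw [← expMeasure_real_Ioi (by linarith), ofReal_measureReal]
    simp only [hI2]
    rw [← ENNReal.ofReal_prod_of_nonneg, prod_ite_mem_ite_mem hAB]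
    · congr 1
      have e1 : Real.exp (-b) = Real.exp (-a) * Real.exp (-(b - a)) := by
        rw [← Real.exp_add]
        congr 1
        ring
      have e2 : n - A.card = (B.card - A.card) + (n - B.card) := by omega
      rw [e1, e2, pow_add, mul_pow, ← mul_one_sub, mul_pow]
      ring
    · intro k _
      split_ifs
      · simpa using ha
      · simp only [sub_nonneg, Real.exp_le_exp]
        linarith
      · exact Real.exp_nonneg _
  · filter_upwards [hnn] with ω hω
    exact hpos _ _ hω.1 hω.2
  · exact ((hm1.comp hL1).mul (hm2.comp hL2)).aestronglyMeasurable

lemma IsLFMOModel.measureReal_failedSet [IsProbabilityMeasure P] (h : IsLFMOModel L ε P)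
    (s : ℝ≥0) (A : Finset (Fin n)) :
    P.real {ω | failedSet L ε ω s = A} =
      ∫ ω, (1 - Real.exp (-L s ω)) ^ A.card * Real.exp (-L s ω) ^ (n - A.card) ∂P := by
  -- Taking a zero time step makes the second factor `1`.
  have h1 := h.measureReal_failedSet_pair s 0 (Finset.Subset.refl A)
  have h2 : ∫ ω, (1 - Real.exp (-L 0 ω)) ^ (A.card - A.card) *
      Real.exp (-L 0 ω) ^ (n - A.card) ∂P = 1 := by
    have : ∀ᵐ ω ∂P, (1 - Real.exp (-L 0 ω)) ^ (A.card - A.card) *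
      Real.exp (-L 0 ω) ^ (n - A.card) = 1 := by
      filter_upwards [h.subordinator.zero] with ω hω
      simp [hω]
    rw [integral_congr_ae this]
    simp
  rw [h2, mul_one, add_zero] at h1
  simpa only [and_self] using h1

lemma measureReal_eq_sum_fiber [IsProbabilityMeasure P] {κ : Type*} {f : Ω → κ}
    (s : Finset κ) {E : Set Ω} (hE : ∀ a ∈ s, MeasurableSet {ω | f ω = a ∧ ω ∈ E})
    (hs : ∀ ω ∈ E, f ω ∈ s) : P.real E = ∑ a ∈ s, P.real {ω | f ω = a ∧ ω ∈ E} := by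
  rw [← measureReal_biUnion_finset _ hE]
  · congr 1
    ext ω
    simp only [mem_iUnion, mem_ofPred_eq, exists_prop]
    exact ⟨fun h => ⟨_, hs ω h, rfl, h⟩, fun ⟨_, _, _, h⟩ => h⟩
  · intro a _ b _ hab
    refine Set.disjoint_left.2 fun ω h1 h2 => hab ?_
    exact h1.1.symm.trans h2.1

lemma card_filter_superset_powersetCard (A : Finset (Fin n)) {j : ℕ} (hj : A.card ≤ j) :
    ((Finset.powersetCard j (Finset.univ : Finset (Fin n))).filter (fun B => A ⊆ B)).card =
      (n - A.card).choose (j - A.card) := by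
  have h : (Finset.powersetCard (j - A.card) Aᶜ).card = (n - A.card).choose (j - A.card) := by
    rw [Finset.card_powersetCard, Finset.card_compl, Fintype.card_fin]
  rw [← h]
  refine Finset.card_bij' (fun B _ => B \ A) (fun C _ => A ∪ C) ?_ ?_ ?_ ?_
  · intro B hB
    simp only [Finset.mem_filter, Finset.mem_powersetCard, Finset.subset_univ, true_and] at hB ⊢
    refine ⟨fun x hx => by simpa using (Finset.mem_sdiff.1 hx).2, ?_⟩
    rw [Finset.card_sdiff_of_subset hB.2, hB.1]
  · intro C hC
    simp only [Finset.mem_filter, Finset.mem_powersetCard, Finset.subset_univ, true_and] at hC ⊢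
    refine ⟨?_, Finset.subset_union_left⟩
    rw [Finset.card_union_of_disjoint, hC.2]
    · omega
    · exact Finset.disjoint_left.2 fun x hx hx' => (Finset.mem_compl.1 (hC.1 hx')) hx
  · intro B hB
    exact Finset.union_sdiff_of_subset (Finset.mem_filter.1 hB).2
  · intro C hC
    rw [Finset.mem_powersetCard] at hC
    rw [Finset.union_sdiff_left, Finset.sdiff_eq_self_iff_disjoint]
    exact Finset.disjoint_left.2 fun x hx hx' => (Finset.mem_compl.1 (hC.1 hx)) hx'

/-- The probability that, among `n - i` surviving components, exactly `j - i` fail within the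
next `t` units of time. -/
noncomputable def stepProb (n : ℕ) (L : ℝ≥0 → Ω → ℝ) (P : Measure Ω) (t : ℝ≥0) (i j : ℕ) : ℝ :=
  (n - i).choose (j - i) *
    ∫ ω, (1 - Real.exp (-L t ω)) ^ (j - i) * Real.exp (-L t ω) ^ (n - j) ∂P

/-- The factor for passing from the failed set `A` to `B ⊇ A` depends only on the sizes, and each
`A` of size `i` has `(n - i).choose (j - i)` supersets of size `j`. -/
lemma IsLFMOModel.measureReal_failureCount_pair [IsProbabilityMeasure P] (h : IsLFMOModel L ε P)
    (s t : ℝ≥0) {i j : ℕ} (hij : i ≤ j) :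
    P.real {ω | failureCount L ε ω s = i ∧ failureCount L ε ω (s + t) = j} =
      P.real {ω | failureCount L ε ω s = i} * stepProb n L P t i j := by
  have hmem : ∀ ω t i, failureCount L ε ω t = i →
      failedSet L ε ω t ∈ Finset.powersetCard i (Finset.univ : Finset (Fin n)) := fun ω t i hi =>
    Finset.mem_powersetCard.2 ⟨Finset.subset_univ _, hi⟩
  have hmc : ∀ t i, MeasurableSet {ω | failureCount L ε ω t = i} := fun t i =>
    h.measurable_failureCount t (measurableSet_singleton i)
  rw [measureReal_eq_sum_fiber
      (E := {ω | failureCount L ε ω s = i ∧ failureCount L ε ω (s + t) = j}) (f := fun ω => failedSet L ε ω s) (Finset.powersetCard i Finset.univ)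
      (fun A _ => (h.measurableSet_failedSet_eq s A).inter ((hmc s i).inter (hmc (s + t) j)))
      (fun ω hω => hmem ω s i hω.1),
    measureReal_eq_sum_fiber (E := {ω | failureCount L ε ω s = i})
      (f := fun ω => failedSet L ε ω s) (Finset.powersetCard i Finset.univ)
      (fun A _ => (h.measurableSet_failedSet_eq s A).inter (hmc s i))
      (fun ω hω => hmem ω s i hω), Finset.sum_mul]
  refine Finset.sum_congr rfl fun A hA => ?_
  rw [Finset.mem_powersetCard_univ] at hA
  have e1 : {ω | failedSet L ε ω s = A ∧ ω ∈ {ω | failureCount L ε ω s = i}} =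
      {ω | failedSet L ε ω s = A} := by
    ext ω
    simp only [mem_ofPred_eq, and_iff_left_iff_imp, ← card_failedSet]
    exact fun h => h ▸ hA
  have e2 : {ω | failedSet L ε ω s = A ∧
      ω ∈ {ω | failureCount L ε ω s = i ∧ failureCount L ε ω (s + t) = j}} =
      {ω | failedSet L ε ω s = A ∧ failureCount L ε ω (s + t) = j} := by
    ext ω
    simp only [mem_ofPred_eq, ← card_failedSet]
    exact ⟨fun h => ⟨h.1, h.2.2⟩, fun h => ⟨h.1, h.1 ▸ hA, h.2⟩⟩
  rw [e1, e2, measureReal_eq_sum_fiber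
      (E := {ω | failedSet L ε ω s = A ∧ failureCount L ε ω (s + t) = j}) (f := fun ω => failedSet L ε ω (s + t))
      (Finset.powersetCard j Finset.univ) (fun B _ => (h.measurableSet_failedSet_eq (s + t) B).inter
        ((h.measurableSet_failedSet_eq s A).inter (hmc (s + t) j)))
      (fun ω hω => hmem ω (s + t) j hω.2)]
  have e3 : ∀ B ∈ Finset.powersetCard j (Finset.univ : Finset (Fin n)),
      P.real {ω | failedSet L ε ω (s + t) = B ∧
        ω ∈ {ω | failedSet L ε ω s = A ∧ failureCount L ε ω (s + t) = j}} =
      if A ⊆ B then P.real {ω | failedSet L ε ω s = A} *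
        ∫ ω, (1 - Real.exp (-L t ω)) ^ (j - i) * Real.exp (-L t ω) ^ (n - j) ∂P else 0 := by
    intro B hB
    rw [Finset.mem_powersetCard_univ] at hB
    have e4 : {ω | failedSet L ε ω (s + t) = B ∧
        ω ∈ {ω | failedSet L ε ω s = A ∧ failureCount L ε ω (s + t) = j}} =
        {ω | failedSet L ε ω s = A ∧ failedSet L ε ω (s + t) = B} := by
      ext ω
      simp only [mem_ofPred_eq, ← card_failedSet]
      exact ⟨fun h => ⟨h.2.1, h.1⟩, fun h => ⟨h.2, h.1, h.2 ▸ hB⟩⟩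
    rw [e4]
    split_ifs with hAB
    · rw [h.measureReal_failedSet_pair s t hAB, h.measureReal_failedSet, hA, hB]
    · rw [measureReal_eq_zero_iff]
      refine measure_mono_null ?_
        ((ae_iff (p := fun ω => Monotone fun t => L t ω)).1 h.subordinator.monotone)
      refine fun ω hω hm => hAB ?_
      rw [← hω.1, ← hω.2]
      exact Finset.monotone_filter_right _ fun _ _ hi => le_trans hi (hm le_self_add)
  rw [Finset.sum_congr rfl e3, ← Finset.sum_filter, Finset.sum_const,
    card_filter_superset_powersetCard A (hA.trans_le hij), hA, nsmul_eq_mul, stepProb]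
  ring

end TwoTimes

/-! ### The chain of failure counts on a fine grid -/

section Grid

open Filter Topology

variable {Ω : Type*} {n : ℕ} {L : ℝ≥0 → Ω → ℝ} {ε : Fin n → Ω → ℝ}

/-- The vector of lifetimes, computed along the rational times. -/
noncomputable def rationalLifetimes (L : ℝ≥0 → Ω → ℝ) (ε : Fin n → Ω → ℝ) (ω : Ω) :
    Fin n → ℝ≥0∞ :=
  fun i => rationalPassage (fun t => L t ω) (ε i ω)

variable [MeasurableSpace Ω] {P : Measure Ω}

lemma IsLFMOModel.ae_failureCount_eq [IsProbabilityMeasure P] (h : IsLFMOModel L ε P)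
    (hL : ¬ (∀ᵐ ω ∂P, L 1 ω = 0)) :
    ∀ᵐ ω ∂P, (∀ i, rationalLifetimes L ε ω i ≠ 0) ∧ (∀ i, rationalLifetimes L ε ω i ≠ ⊤) ∧
      (∀ t : ℝ≥0, failureCount L ε ω t = elapsedCount (rationalLifetimes L ε ω) t) ∧
      (fun i => lifetime L ε i ω) = rationalLifetimes L ε ω := by
  filter_upwards [h.ae_lifetime hL] with ω hω
  obtain ⟨h1, h2, h3, h4⟩ := hω
  have h5 : (fun i => lifetime L ε i ω) = rationalLifetimes L ε ω := funext h4
  refine ⟨fun i => ?_, fun i => ?_, fun t => ?_, h5⟩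
  · rw [← h5]
    exact h1 i
  · rw [← h5]
    exact h2 i
  · rw [← h5]
    simp only [failureCount, elapsedCount, h3]

lemma IsLFMOModel.ae_exists_failureCount_eq [IsProbabilityMeasure P] (h : IsLFMOModel L ε P)
    (hL : ¬ (∀ᵐ ω ∂P, L 1 ω = 0)) {δ : ℝ≥0} (hδ : 0 < δ) :
    ∀ᵐ ω ∂P, ∃ m : ℕ, failureCount L ε ω (m * δ) = n := by
  filter_upwards [h.ae_failureCount_eq hL] with ω hω
  obtain ⟨-, h2, h3, -⟩ := hω
  have hsup : Finset.univ.sup (rationalLifetimes L ε ω) ≠ ⊤ :=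
    ((Finset.sup_lt_iff ENNReal.zero_lt_top).2 fun i _ => (h2 i).lt_top).ne
  obtain ⟨m, hm⟩ := exists_le_nat_mul hsup hδ
  refine ⟨m, ?_⟩
  rw [h3, elapsedCount, Finset.filter_true_of_mem, Finset.card_univ, Fintype.card_fin]
  exact fun i hi => (Finset.le_sup hi).trans hm

lemma IsLFMOModel.ae_monotone_failureCount (h : IsLFMOModel L ε P) :
    ∀ᵐ ω ∂P, Monotone (failureCount L ε ω) := by
  filter_upwards [h.subordinator.monotone] with ω hω s t hst
  exact Finset.card_le_card (Finset.monotone_filter_right _ fun _ _ hi => le_trans hi (hω hst))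

lemma IsLevySubordinator.stepProb_nonneg (h : IsLevySubordinator L P) (t : ℝ≥0) (i j : ℕ) :
    0 ≤ stepProb n L P t i j := by
  refine mul_nonneg (Nat.cast_nonneg _) (integral_nonneg_of_ae ?_)
  filter_upwards [h.ae_nonneg] with ω hω
  have h1 : 0 ≤ 1 - Real.exp (-L t ω) := by simpa using hω t
  simp only [Pi.zero_apply]
  positivity

lemma IsLevySubordinator.integral_exp_pow_inv [IsProbabilityMeasure P]
    (h : IsLevySubordinator L P) (N m : ℕ) :
    ∫ ω, Real.exp (-L ((N : ℝ≥0) + 1)⁻¹ ω) ^ m ∂P =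
      Real.exp (-(laplaceExponent L P m * ((N : ℝ) + 1)⁻¹)) := by
  rw [← h.integral_exp_inv (Nat.cast_nonneg m)]
  refine integral_congr_ae (Eventually.of_forall fun ω => ?_)
  dsimp only
  rw [← Real.exp_nat_mul]
  congr 1
  ring

lemma IsLevySubordinator.stepProb_self [IsProbabilityMeasure P]
    (h : IsLevySubordinator L P) (N i : ℕ) :
    stepProb n L P ((N : ℝ≥0) + 1)⁻¹ i i =
      Real.exp (-(laplaceExponent L P (n - i : ℕ) * ((N : ℝ) + 1)⁻¹)) := by
  simp [stepProb, h.integral_exp_pow_inv]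

lemma IsLevySubordinator.stepProb_eq_sum [IsProbabilityMeasure P]
    (h : IsLevySubordinator L P) (N : ℕ) {i j : ℕ} (hij : i < j) :
    stepProb n L P ((N : ℝ≥0) + 1)⁻¹ i j = (n - i).choose (j - i) *
      ∑ k ∈ Finset.range (j - i), ((j - i - 1).choose k : ℝ) * (-1) ^ k *
        (Real.exp (-(laplaceExponent L P (n - j + k : ℕ) * ((N : ℝ) + 1)⁻¹)) -
          Real.exp (-(laplaceExponent L P (n - j + k + 1 : ℕ) * ((N : ℝ) + 1)⁻¹))) := by
  have hint : ∀ m : ℕ, Integrable (fun ω => Real.exp (-L ((N : ℝ≥0) + 1)⁻¹ ω) ^ m) P := by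
    intro m
    refine (h.integrable_exp (Nat.cast_nonneg m) ((N : ℝ≥0) + 1)⁻¹).congr
      (Eventually.of_forall fun ω => ?_)
    dsimp only
    rw [← Real.exp_nat_mul]
    congr 1
    ring
  rw [stepProb]
  congr 1
  obtain ⟨v, hv⟩ : ∃ v, j - i = v + 1 := ⟨j - i - 1, by omega⟩
  rw [hv, Nat.add_sub_cancel]
  -- Only `v` of the `v + 1` factors `1 - e` are expanded; the last one yields the differences that
  -- become increments of `Ψ`.
  have hexpand : ∀ e : ℝ, (1 - e) ^ (v + 1) * e ^ (n - j) =
      ∑ k ∈ Finset.range (v + 1), (v.choose k : ℝ) * (-1) ^ k *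
        (e ^ (n - j + k) - e ^ (n - j + k + 1)) := by
    intro e
    rw [pow_succ, sub_eq_neg_add 1 e, add_pow, Finset.sum_mul, Finset.sum_mul]
    refine Finset.sum_congr rfl fun k _ => ?_
    rw [neg_pow, pow_add, pow_add, pow_add]
    ring
  simp only [hexpand]
  have hint2 : ∀ k ∈ Finset.range (v + 1), Integrable (fun ω => (v.choose k : ℝ) * (-1) ^ k *
      (Real.exp (-L ((N : ℝ≥0) + 1)⁻¹ ω) ^ (n - j + k) -
        Real.exp (-L ((N : ℝ≥0) + 1)⁻¹ ω) ^ (n - j + k + 1))) P :=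
    fun k _ => ((hint _).sub (hint _)).const_mul _
  rw [integral_finsetSum _ hint2]
  refine Finset.sum_congr rfl fun k _ => ?_
  rw [integral_const_mul, integral_sub (hint _) (hint _), h.integral_exp_pow_inv,
    h.integral_exp_pow_inv]

/-- A difference quotient at `0`, taken along `1/(N + 1)`. -/
lemma tendsto_mul_exp_sub_exp (a b : ℝ) :
    Tendsto (fun N : ℕ => ((N : ℝ) + 1) * (Real.exp (-(a * ((N : ℝ) + 1)⁻¹)) -
      Real.exp (-(b * ((N : ℝ) + 1)⁻¹)))) atTop (𝓝 (b - a)) := by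
  have hd : HasDerivAt (fun x : ℝ => Real.exp (-(a * x)) - Real.exp (-(b * x))) (b - a) 0 := by
    have h1 : ∀ c : ℝ, HasDerivAt (fun x : ℝ => Real.exp (-(c * x))) (-c) 0 := by
      intro c
      have := ((hasDerivAt_id (0 : ℝ)).const_mul c).neg.exp
      simpa using this
    have := (h1 a).sub (h1 b)
    rwa [neg_sub_neg] at this
  have hlim : Tendsto (fun N : ℕ => ((N : ℝ) + 1)⁻¹) atTop (𝓝[>] 0) :=
    tendsto_inv_atTop_nhdsGT_zero.comp
      (tendsto_atTop_add_const_right _ _ tendsto_natCast_atTop_atTop)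
  have := hd.tendsto_slope_zero_right.comp hlim
  simpa [Function.comp_def] using this

lemma IsLevySubordinator.tendsto_stepProb [IsProbabilityMeasure P]
    (h : IsLevySubordinator L P) {i j : ℕ} (hij : i < j) (hjn : j ≤ n) :
    Tendsto (fun N : ℕ => ((N : ℝ) + 1) * stepProb n L P ((N : ℝ≥0) + 1)⁻¹ i j) atTop
      (𝓝 ((n - i).choose (j - i) * shockRate (laplaceExponent L P) (n - i) (j - i))) := by
  have h1 : n - i - (j - i) = n - j := by omega
  simp only [h.stepProb_eq_sum _ hij, shockRate, h1]
  have h2 := tendsto_finsetSum (Finset.range (j - i)) fun k _ =>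
    (tendsto_mul_exp_sub_exp (laplaceExponent L P (n - j + k : ℕ))
      (laplaceExponent L P (n - j + k + 1 : ℕ))).const_mul (((j - i - 1).choose k : ℝ) * (-1) ^ k)
  refine (h2.const_mul _).congr fun N => ?_
  rw [mul_left_comm ((N : ℝ) + 1), Finset.mul_sum (a := (N : ℝ) + 1)]
  congr 1
  exact Finset.sum_congr rfl fun k _ => mul_left_comm _ _ _

lemma IsLevySubordinator.tendsto_one_sub_stepProb [IsProbabilityMeasure P]
    (h : IsLevySubordinator L P) (i : ℕ) :
    Tendsto (fun N : ℕ => ((N : ℝ) + 1) * (1 - stepProb n L P ((N : ℝ≥0) + 1)⁻¹ i i)) atTop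
      (𝓝 (laplaceExponent L P (n - i : ℕ))) := by
  have h1 := tendsto_mul_exp_sub_exp 0 (laplaceExponent L P (n - i : ℕ))
  simpa [h.stepProb_self] using h1

/-- Along a grid, the chain of failure counts jumps from `i` to `j` with the probability of
visiting `i` times the conditional probability of the jump. -/
lemma IsLFMOModel.measureReal_grid_jump_mul [IsProbabilityMeasure P] (h : IsLFMOModel L ε P)
    (hL : ¬ (∀ᵐ ω ∂P, L 1 ω = 0)) {δ : ℝ≥0} (hδ : 0 < δ) {i j : ℕ} (hij : i < j) (hin : i < n)
    (hstep : stepProb n L P δ i i ≤ 1) :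
    P.real {ω | ∃ m : ℕ, failureCount L ε ω (m * δ) = i ∧
        failureCount L ε ω ((m + 1 : ℕ) * δ) = j} * (1 - stepProb n L P δ i i) =
      P.real {ω | ∃ m : ℕ, failureCount L ε ω (m * δ) = i} * stepProb n L P δ i j := by
  have hmc : ∀ t i, MeasurableSet {ω | failureCount L ε ω t = i} := fun t i =>
    h.measurable_failureCount t (measurableSet_singleton i)
  have hsucc : ∀ m : ℕ, ((m + 1 : ℕ) : ℝ≥0) * δ = m * δ + δ := fun m => by
    push_cast
    ring
  -- A nondecreasing count can leave `i` at most once, so departures at different grid times are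
  -- almost surely disjoint.
  have hdisj : ∀ E : ℕ → Set Ω, (∀ m, E m ⊆ {ω | failureCount L ε ω (m * δ) = i ∧
      failureCount L ε ω ((m + 1 : ℕ) * δ) ≠ i}) → Pairwise (Function.onFun (AEDisjoint P) E) := by
    have key : ∀ E : ℕ → Set Ω, (∀ m, E m ⊆ {ω | failureCount L ε ω (m * δ) = i ∧
        failureCount L ε ω ((m + 1 : ℕ) * δ) ≠ i}) → ∀ a b, a < b → AEDisjoint P (E a) (E b) := by
      intro E hE a b hab
      refine measure_mono_null ?_
        ((ae_iff (p := fun ω => Monotone (failureCount L ε ω))).1 h.ae_monotone_failureCount)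
      refine fun ω hω hm => ?_
      have h1 := hE a hω.1
      have h2 := hE b hω.2
      have h3 : failureCount L ε ω (a * δ) ≤ failureCount L ε ω ((a + 1 : ℕ) * δ) :=
        hm (by gcongr; omega)
      have h4 : failureCount L ε ω ((a + 1 : ℕ) * δ) ≤ failureCount L ε ω (b * δ) :=
        hm (by gcongr; omega)
      rw [h1.1] at h3
      rw [h2.1] at h4
      exact h1.2 (le_antisymm h4 h3)
    intro E hE a b hab
    rcases lt_or_gt_of_ne hab with h1 | h1
    · exact key E hE a b h1
    · exact (key E hE b a h1).symm
  have hD : P {ω | ∃ m : ℕ, failureCount L ε ω (m * δ) = i ∧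
        failureCount L ε ω ((m + 1 : ℕ) * δ) = j} =
      (∑' m : ℕ, P {ω | failureCount L ε ω (m * δ) = i}) *
        ENNReal.ofReal (stepProb n L P δ i j) := by
    have hmeas : ∀ m : ℕ, NullMeasurableSet {ω | failureCount L ε ω (m * δ) = i ∧
        failureCount L ε ω ((m + 1 : ℕ) * δ) = j} P := fun m =>
      ((hmc _ _).inter (hmc _ _)).nullMeasurableSet
    rw [ofPred_exists, measure_iUnion₀ (hdisj _ ?_) hmeas, ← ENNReal.tsum_mul_right]
    · congr 1
      funext m
      rw [← ofReal_measureReal (μ := P), ← ofReal_measureReal (μ := P), hsucc,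
        h.measureReal_failureCount_pair _ _ hij.le, ENNReal.ofReal_mul measureReal_nonneg]
    · exact fun m ω hω => ⟨hω.1, fun h => hij.ne (h.symm.trans hω.2)⟩
  have hV : P {ω | ∃ m : ℕ, failureCount L ε ω (m * δ) = i} =
      (∑' m : ℕ, P {ω | failureCount L ε ω (m * δ) = i}) *
        ENNReal.ofReal (1 - stepProb n L P δ i i) := by
    -- Since the count almost surely reaches `n > i`, every visit to `i` ends with a departure;
    -- visits can therefore be counted by departures.
    have hae : P {ω | ∃ m : ℕ, failureCount L ε ω (m * δ) = i} =
        P {ω | ∃ m : ℕ, failureCount L ε ω (m * δ) = i ∧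
          failureCount L ε ω ((m + 1 : ℕ) * δ) ≠ i} := by
      apply measure_congr
      filter_upwards [h.ae_monotone_failureCount, h.ae_exists_failureCount_eq hL hδ] with ω hm hex
      refine propext ⟨?_, fun ⟨m, hm⟩ => ⟨m, hm.1⟩⟩
      rintro ⟨m, hmi⟩
      by_contra hcon
      have hstay : ∀ k : ℕ, failureCount L ε ω ((m + k : ℕ) * δ) = i := by
        intro k
        induction k with
        | zero => exact hmi
        | succ k ih =>
          by_contra h1
          exact hcon ⟨m + k, ih, h1⟩
      obtain ⟨M, hM⟩ := hex
      have h1 := hstay M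
      have h2 : failureCount L ε ω (M * δ) ≤ failureCount L ε ω ((m + M : ℕ) * δ) :=
        hm (by gcongr; omega)
      omega
    have hmeas : ∀ m : ℕ, NullMeasurableSet {ω | failureCount L ε ω (m * δ) = i ∧
        failureCount L ε ω ((m + 1 : ℕ) * δ) ≠ i} P := fun m =>
      ((hmc _ _).inter (hmc _ _).compl).nullMeasurableSet
    rw [hae, ofPred_exists, measure_iUnion₀ (hdisj _ fun m => Subset.rfl) hmeas,
      ← ENNReal.tsum_mul_right]
    congr 1
    funext m
    have hsd : {ω | failureCount L ε ω (m * δ) = i ∧ failureCount L ε ω ((m + 1 : ℕ) * δ) ≠ i} =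
        {ω | failureCount L ε ω (m * δ) = i} \ {ω | failureCount L ε ω (m * δ) = i ∧
          failureCount L ε ω ((m + 1 : ℕ) * δ) = i} := by
      ext ω
      simp only [mem_ofPred_eq, Set.mem_sdiff]
      tauto
    have hboth : MeasurableSet {ω | failureCount L ε ω (m * δ) = i ∧
        failureCount L ε ω ((m + 1 : ℕ) * δ) = i} := (hmc _ _).inter (hmc _ _)
    have hsub : {ω | failureCount L ε ω (m * δ) = i ∧ failureCount L ε ω ((m + 1 : ℕ) * δ) = i} ⊆
        {ω | failureCount L ε ω (m * δ) = i} := fun ω hω => hω.1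
    rw [← ofReal_measureReal (μ := P), ← ofReal_measureReal (μ := P), hsd,
      measureReal_sdiff hsub hboth, hsucc,
      h.measureReal_failureCount_pair _ _ le_rfl, ← ENNReal.ofReal_mul measureReal_nonneg,
      mul_one_sub]
  rw [measureReal_def, measureReal_def, hD, hV]
  simp only [ENNReal.toReal_mul]
  rw [ENNReal.toReal_ofReal (h.subordinator.stepProb_nonneg δ i j),
    ENNReal.toReal_ofReal (sub_nonneg.2 hstep)]
  ring

/-- The limit set need not be measurable: it agrees almost everywhere with the set of points
eventually in `E N`. -/
lemma tendsto_measureReal_of_ae_eventually_iff [IsFiniteMeasure P] {E : ℕ → Set Ω} {A : Set Ω}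
    (hE : ∀ N, MeasurableSet (E N)) (h : ∀ᵐ ω ∂P, ∀ᶠ N in atTop, ω ∈ E N ↔ ω ∈ A) :
    Tendsto (fun N => P.real (E N)) atTop (𝓝 (P.real A)) := by
  have h1 : A =ᵐ[P] {ω | ∀ᶠ N in atTop, ω ∈ E N} := by
    filter_upwards [h] with ω hω
    refine propext ⟨fun hA => ?_, fun hA => ?_⟩
    · exact hω.mono fun N hN => hN.2 hA
    · obtain ⟨N, hN1, hN2⟩ := (hω.and hA).exists
      exact hN1.1 hN2
  rw [measureReal_congr h1]
  refine (ENNReal.tendsto_toReal (measure_ne_top _ _)).comp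
    (tendsto_measure_of_ae_tendsto_indicator_of_isFiniteMeasure atTop ?_ hE ?_)
  · have h2 : {ω | ∀ᶠ N in atTop, ω ∈ E N} = ⋃ a, ⋂ b, ⋂ (_ : a ≤ b), E b := by
      ext ω
      simp [eventually_atTop]
    rw [h2]
    exact MeasurableSet.iUnion fun a => MeasurableSet.iInter fun b =>
      MeasurableSet.iInter fun _ => hE b
  · filter_upwards [h, h1.mem_iff] with ω hω h2
    exact hω.mono fun N hN => hN.trans h2

/-- The embedded chain leaves `i` for `j` with probability `transitionProb n Ψ i j`. -/
lemma IsLFMOModel.measureReal_visit_and_jump [IsProbabilityMeasure P] (h : IsLFMOModel L ε P)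
    (hL : ¬ (∀ᵐ ω ∂P, L 1 ω = 0)) {i j : ℕ} (hij : i < j) (hjn : j ≤ n) :
    P.real {ω | (∃ y, elapsedCount (rationalLifetimes L ε ω) y = i) ∧
        elapsedCount (rationalLifetimes L ε ω)
          (orderStatistic (rationalLifetimes L ε ω) (i + 1)) = j} =
      P.real {ω | ∃ y, elapsedCount (rationalLifetimes L ε ω) y = i} *
        transitionProb n (laplaceExponent L P) i j := by
  have hmc : ∀ t i, MeasurableSet {ω | failureCount L ε ω t = i} := fun t i =>
    h.measurable_failureCount t (measurableSet_singleton i)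
  have hδ : Tendsto (fun N : ℕ => ((N : ℝ≥0) + 1)⁻¹) atTop (𝓝[>] 0) := by
    refine tendsto_nhdsWithin_iff.2 ⟨?_, Eventually.of_forall fun N => ?_⟩
    · rw [← NNReal.tendsto_coe]
      simpa [one_div] using tendsto_one_div_add_atTop_nhds_zero_nat (𝕜 := ℝ)
    · exact (by positivity : (0 : ℝ≥0) < ((N : ℝ≥0) + 1)⁻¹)
  have hΨ : 0 < laplaceExponent L P (n - i : ℕ) :=
    h.subordinator.laplaceExponent_pos hL (by exact_mod_cast (by omega : 0 < n - i))
  have hV : Tendsto (fun N : ℕ => P.real {ω | ∃ m : ℕ,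
      failureCount L ε ω (m * ((N : ℝ≥0) + 1)⁻¹) = i}) atTop
      (𝓝 (P.real {ω | ∃ y, elapsedCount (rationalLifetimes L ε ω) y = i})) := by
    refine tendsto_measureReal_of_ae_eventually_iff (fun N => ?_) ?_
    · rw [ofPred_exists]
      exact MeasurableSet.iUnion fun m => hmc _ _
    · filter_upwards [h.ae_failureCount_eq hL] with ω hω
      simp only [hω.2.2.1]
      exact hδ.eventually (eventually_exists_grid_visit_iff (by omega))
  have hD : Tendsto (fun N : ℕ => P.real {ω | ∃ m : ℕ,
      failureCount L ε ω (m * ((N : ℝ≥0) + 1)⁻¹) = i ∧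
      failureCount L ε ω ((m + 1 : ℕ) * ((N : ℝ≥0) + 1)⁻¹) = j}) atTop
      (𝓝 (P.real {ω | (∃ y, elapsedCount (rationalLifetimes L ε ω) y = i) ∧
        elapsedCount (rationalLifetimes L ε ω)
          (orderStatistic (rationalLifetimes L ε ω) (i + 1)) = j})) := by
    refine tendsto_measureReal_of_ae_eventually_iff (fun N => ?_) ?_
    · rw [ofPred_exists]
      exact MeasurableSet.iUnion fun m => (hmc _ _).inter (hmc _ _)
    · filter_upwards [h.ae_failureCount_eq hL] with ω hω
      simp only [hω.2.2.1]
      exact hδ.eventually (eventually_exists_grid_jump_iff hω.2.1 hij hjn)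
  have hlim1 := hD.mul (h.subordinator.tendsto_one_sub_stepProb (n := n) i)
  have hlim2 := hV.mul (h.subordinator.tendsto_stepProb (n := n) hij hjn)
  have heq : ∀ N : ℕ, P.real {ω | ∃ m : ℕ,
      failureCount L ε ω (m * ((N : ℝ≥0) + 1)⁻¹) = i ∧
      failureCount L ε ω ((m + 1 : ℕ) * ((N : ℝ≥0) + 1)⁻¹) = j} *
        (((N : ℝ) + 1) * (1 - stepProb n L P ((N : ℝ≥0) + 1)⁻¹ i i)) =
      P.real {ω | ∃ m : ℕ, failureCount L ε ω (m * ((N : ℝ≥0) + 1)⁻¹) = i} *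
        (((N : ℝ) + 1) * stepProb n L P ((N : ℝ≥0) + 1)⁻¹ i j) := by
    intro N
    have hstep : stepProb n L P ((N : ℝ≥0) + 1)⁻¹ i i ≤ 1 := by
      rw [h.subordinator.stepProb_self, Real.exp_le_one_iff]
      exact neg_nonpos.2 (by positivity)
    rw [mul_left_comm, h.measureReal_grid_jump_mul hL (by positivity) hij (by omega) hstep,
      mul_left_comm]
  simp only [heq] at hlim1
  have := tendsto_nhds_unique hlim1 hlim2
  rw [transitionProb, if_pos ⟨hij, hjn⟩, mul_div_assoc', eq_div_iff hΨ.ne', this]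

end Grid

/-! ### Exchangeability of the lifetimes -/

section Final

variable {Ω : Type*} [MeasurableSpace Ω] {P : Measure Ω} {n : ℕ}
  {L : ℝ≥0 → Ω → ℝ} {ε : Fin n → Ω → ℝ}

/-- Permuting iid triggers preserves their joint law and their independence of the path. -/
lemma IsLFMOModel.map_path_triggers_perm [IsProbabilityMeasure P] (h : IsLFMOModel L ε P)
    (σ : Equiv.Perm (Fin n)) :
    P.map (fun ω => ((fun t => L t ω), fun i => ε (σ i) ω)) =
      P.map (fun ω => ((fun t => L t ω), fun i => ε i ω)) := by
  have hσm : Measurable (fun ω i => ε (σ i) ω) :=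
    measurable_pi_iff.2 fun i => h.measurable_trigger (σ i)
  have hind : IndepFun (fun ω t => L t ω) (fun ω i => ε (σ i) ω) P :=
    h.indep.comp (ψ := fun e : Fin n → ℝ => fun i => e (σ i)) measurable_id
      (measurable_pi_iff.2 fun i => measurable_pi_apply (σ i))
  have hlaw : P.map (fun ω i => ε (σ i) ω) = P.map (fun ω i => ε i ω) := by
    rw [h.map_triggers, (iIndepFun_iff_map_fun_eq_pi_map
      fun i => (h.measurable_trigger (σ i)).aemeasurable).1 (h.iIndep_trigger.precomp σ.injective)]
    congr 1
    funext i
    exact (h.trigger_law (σ i)).map_eq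
  rw [(indepFun_iff_map_prod_eq_prod_map_map h.subordinator.measurable_path.aemeasurable
      hσm.aemeasurable).1 hind, hlaw, (indepFun_iff_map_prod_eq_prod_map_map
      h.subordinator.measurable_path.aemeasurable h.measurable_triggers.aemeasurable).1 h.indep]

lemma IsLFMOModel.measurable_rationalLifetimes (h : IsLFMOModel L ε P) :
    Measurable (rationalLifetimes L ε) :=
  measurable_pi_iff.2 fun i => measurable_rationalPassage.comp
    (h.subordinator.measurable_path.prodMk (h.measurable_trigger i))

lemma IsLFMOModel.measureReal_lifetimes_perm [IsProbabilityMeasure P] (h : IsLFMOModel L ε P)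
    (σ : Equiv.Perm (Fin n)) {C : Set (Fin n → ℝ≥0∞)} (hC : MeasurableSet C) :
    P.real {ω | (fun i => rationalLifetimes L ε ω (σ i)) ∈ C} =
      P.real {ω | rationalLifetimes L ε ω ∈ C} := by
  set G : (ℝ≥0 → ℝ) × (Fin n → ℝ) → Fin n → ℝ≥0∞ := fun p i => rationalPassage p.1 (p.2 i) with hG
  have hGm : Measurable G := measurable_pi_iff.2 fun i => measurable_rationalPassage.comp
    (measurable_fst.prodMk ((measurable_pi_apply i).comp measurable_snd))
  have hσm : Measurable (fun ω => ((fun t => L t ω), fun i => ε (σ i) ω)) :=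
    h.subordinator.measurable_path.prodMk
      (measurable_pi_iff.2 fun i => h.measurable_trigger (σ i))
  have hm : Measurable (fun ω => ((fun t => L t ω), fun i => ε i ω)) :=
    h.subordinator.measurable_path.prodMk h.measurable_triggers
  have h1 := congrArg (fun μ : Measure _ => μ.real (G ⁻¹' C)) (h.map_path_triggers_perm σ)
  simp only [map_measureReal_apply hσm (hGm hC), map_measureReal_apply hm (hGm hC)] at h1
  exact h1

lemma integral_ite_one [IsProbabilityMeasure P] {p : Ω → Prop} [DecidablePred p]
    (hp : MeasurableSet {ω | p ω}) : ∫ ω, (if p ω then (1 : ℝ) else 0) ∂P = P.real {ω | p ω} := by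
  rw [← integral_indicator_one hp]
  congr 1
  funext ω
  by_cases h : p ω <;> simp [h]

lemma integrable_ite_one [IsProbabilityMeasure P] {p : Ω → Prop} [DecidablePred p]
    (hp : MeasurableSet {ω | p ω}) : Integrable (fun ω => if p ω then (1 : ℝ) else 0) P := by
  refine Integrable.of_bound (C := 1) ?_ ?_
  · exact (Measurable.ite hp measurable_const measurable_const).aestronglyMeasurable
  · refine Filter.Eventually.of_forall fun ω => ?_
    by_cases h : p ω <;> simp [h]

lemma IsLFMOModel.measurableSet_count_orderStatistic (h : IsLFMOModel L ε P) {k : ℕ} (hk : 1 ≤ k)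
    (hkn : k ≤ n) (j : ℕ) :
    MeasurableSet {ω | elapsedCount (rationalLifetimes L ε ω)
      (orderStatistic (rationalLifetimes L ε ω) k) = j} :=
  measurable_elapsedCount h.measurable_rationalLifetimes
    ((measurable_orderStatistic hk hkn).comp h.measurable_rationalLifetimes)
    (measurableSet_singleton j)

lemma IsLFMOModel.measureReal_count_failureTimeOf [IsProbabilityMeasure P]
    (h : IsLFMOModel L ε P) {Φ : (Fin n → Bool) → Bool} (hΦ : IsSemiCoherent Φ) (j : ℕ) :
    P.real {ω | elapsedCount (rationalLifetimes L ε ω)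
        (failureTimeOf Φ (rationalLifetimes L ε ω)) = j} =
      ∑ k ∈ Finset.Icc 1 n, structuralSignature Φ k *
        P.real {ω | elapsedCount (rationalLifetimes L ε ω)
          (orderStatistic (rationalLifetimes L ε ω) k) = j} := by
  set R := rationalLifetimes L ε with hR
  have hRm : Measurable R := h.measurable_rationalLifetimes
  have hperm : ∀ σ : Equiv.Perm (Fin n),
      P.real {ω | elapsedCount (R ω) (failureTimeOf Φ (fun i => R ω (σ i))) = j} =
        P.real {ω | elapsedCount (R ω) (failureTimeOf Φ (R ω)) = j} := by
    intro σ
    have hC : MeasurableSet {T : Fin n → ℝ≥0∞ | elapsedCount T (failureTimeOf Φ T) = j} :=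
      measurable_elapsedCount measurable_id (measurable_failureTimeOf hΦ)
        (measurableSet_singleton j)
    have h1 := h.measureReal_lifetimes_perm σ hC
    simp only [mem_ofPred_eq, elapsedCount_comp] at h1
    exact h1
  have hmσ : ∀ σ : Equiv.Perm (Fin n),
      MeasurableSet {ω | elapsedCount (R ω) (failureTimeOf Φ (fun i => R ω (σ i))) = j} := by
    intro σ
    have h1 : Measurable fun ω => fun i => R ω (σ i) :=
      measurable_pi_iff.2 fun i => (measurable_pi_apply (σ i)).comp hRm
    exact measurable_elapsedCount hRm ((measurable_failureTimeOf hΦ).comp h1)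
      (measurableSet_singleton j)
  have hmk : ∀ k ∈ Finset.Icc 1 n,
      MeasurableSet {ω | elapsedCount (R ω) (orderStatistic (R ω) k) = j} := fun k hk =>
    h.measurableSet_count_orderStatistic (Finset.mem_Icc.1 hk).1 (Finset.mem_Icc.1 hk).2 j
  have hsum : ∑ σ : Equiv.Perm (Fin n),
      P.real {ω | elapsedCount (R ω) (failureTimeOf Φ (fun i => R ω (σ i))) = j} =
      n.factorial * ∑ k ∈ Finset.Icc 1 n, structuralSignature Φ k *
        P.real {ω | elapsedCount (R ω) (orderStatistic (R ω) k) = j} := by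
    rw [Finset.sum_congr rfl fun σ _ => (integral_ite_one (hmσ σ)).symm,
      ← integral_finsetSum _ fun σ _ => integrable_ite_one (hmσ σ)]
    simp only [sum_perm_elapsedCount_failureTimeOf hΦ]
    rw [integral_const_mul, integral_finsetSum _ fun k hk =>
      (integrable_ite_one (hmk k hk)).const_mul _]
    congr 1
    refine Finset.sum_congr rfl fun k hk => ?_
    rw [integral_const_mul, integral_ite_one (hmk k hk)]
  -- Exchangeability turns the left side into `n!` copies of one probability.
  simp only [hperm, Finset.sum_const, Finset.card_univ, Fintype.card_perm, Fintype.card_fin,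
    nsmul_eq_mul] at hsum
  exact mul_left_cancel₀ (by exact_mod_cast n.factorial_ne_zero) hsum

/-! ### The embedded chain -/

lemma IsLFMOModel.ae_failureCountAt [IsProbabilityMeasure P] (h : IsLFMOModel L ε P)
    (hL : ¬ (∀ᵐ ω ∂P, L 1 ω = 0)) :
    ∀ᵐ ω ∂P, ∀ t, failureCountAt L ε ω t = elapsedCount (rationalLifetimes L ε ω) t := by
  filter_upwards [h.ae_failureCount_eq hL] with ω hω t
  unfold failureCountAt
  split_ifs with ht
  · rw [ht, elapsedCount_top]
  · rw [hω.2.2.1, ENNReal.coe_toNNReal ht]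

/-- The jump times of the count almost surely run through the distinct lifetimes, so
`exists_jump_iff` applies path by path. -/
lemma IsLFMOModel.directJumpProb_eq [IsProbabilityMeasure P] (h : IsLFMOModel L ε P)
    (hL : ¬ (∀ᵐ ω ∂P, L 1 ω = 0)) {i j : ℕ} (hij : i < j) (hjn : j ≤ n) :
    directJumpProb L ε P i j = P.real {ω | elapsedCount (rationalLifetimes L ε ω)
      (orderStatistic (rationalLifetimes L ε ω) (i + 1)) = j} := by
  unfold directJumpProb
  apply measureReal_congr
  filter_upwards [h.ae_failureCount_eq hL, h.ae_failureCountAt hL] with ω hω hat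
  obtain ⟨h0, htop, hcount, -⟩ := hω
  have hfun : failureCount L ε ω = fun t : ℝ≥0 => elapsedCount (rationalLifetimes L ε ω) t :=
    funext hcount
  have hp : ∀ t : ℝ≥0, Function.leftLim (failureCount L ε ω) t < failureCount L ε ω t ↔
      ∃ a, rationalLifetimes L ε ω a = t := by
    intro t
    rw [hfun]
    exact leftLim_elapsedCount_lt_iff h0 t
  have hjump := fun m => iInf_lifetime_after htop (jumpTime L ε ω m) hp
  have key := exists_jump_iff (τ := jumpTime L ε ω) rfl h0 (fun m => (hjump m).1)
    (fun m => (hjump m).2) hij hjn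
  refine propext ?_
  change (i < j ∧ ∃ m, failureCountAt L ε ω (jumpTime L ε ω m) ≤ i ∧
    failureCountAt L ε ω (jumpTime L ε ω (m + 1)) = j) ↔ _
  simp only [hat]
  exact ⟨fun h => key.1 h.2, fun h => ⟨hij, key.2 h⟩⟩

lemma IsLFMOModel.measureReal_count_orderStatistic [IsProbabilityMeasure P]
    (h : IsLFMOModel L ε P) (hL : ¬ (∀ᵐ ω ∂P, L 1 ω = 0)) (i : ℕ) :
    ∀ j, i < j → j ≤ n → P.real {ω | elapsedCount (rationalLifetimes L ε ω)
      (orderStatistic (rationalLifetimes L ε ω) (i + 1)) = j} =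
        recursiveJumpProb n (laplaceExponent L P) i j := by
  induction i with
  | zero =>
    intro j hj hjn
    have h1 := h.measureReal_visit_and_jump hL hj hjn
    -- State `0` is almost surely visited, at time `0`, so the visit probability is `1`.
    have h2 : ∀ᵐ ω ∂P, ∃ y, elapsedCount (rationalLifetimes L ε ω) y = 0 := by
      filter_upwards [h.ae_failureCount_eq hL] with ω hω
      exact ⟨0, elapsedCount_zero hω.1⟩
    have h3 : P.real {ω | ∃ y, elapsedCount (rationalLifetimes L ε ω) y = 0} = 1 :=
      (measureReal_congr (Filter.eventuallyEq_univ.2 h2)).trans probReal_univ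
    rw [h3, one_mul] at h1
    rw [recursiveJumpProb, ← h1]
    apply measureReal_congr
    filter_upwards [h2] with ω hω
    exact propext ⟨fun h => ⟨hω, h⟩, fun h => h.2⟩
  | succ i ih =>
    intro j hj hjn
    rw [recursiveJumpProb, if_pos hj, ← ih j (by omega) hjn, ← ih (i + 1) (by omega) (by omega)]
    have h1 := h.measureReal_visit_and_jump hL hj hjn
    simp only [exists_elapsedCount_eq_iff (Nat.succ_pos i) (show i + 1 ≤ n by omega)] at h1
    -- Either the count at `T_{i+1:n}` is already `j`, or it is exactly `i + 1` and the next jump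
    -- leads to `j`; the cases exclude each other.
    rw [← h1, ← measureReal_union]
    · congr 1
      ext ω
      exact elapsedCount_orderStatistic_succ_iff (Nat.succ_pos i) hj hjn
    · refine Set.disjoint_left.2 fun ω h2 h3 => ?_
      exact hj.ne (h3.1.symm.trans h2)
    · exact (h.measurableSet_count_orderStatistic (Nat.succ_pos i) (by omega) _).inter
        (h.measurableSet_count_orderStatistic (by omega) (by omega) _)

end Final

/-! ### Assembly on the original lifetimes. -/

theorem proposition3 {Ω : Type*} [MeasurableSpace Ω] (P : Measure Ω) [IsProbabilityMeasure P]
    (n : ℕ) (hn : 1 < n) (Φ : (Fin n → Bool) → Bool) (hΦ : IsSemiCoherent Φ)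
    (L : ℝ≥0 → Ω → ℝ) (ε : Fin n → Ω → ℝ) (hmodel : IsLFMOModel L ε P)
    (hL : ¬ (∀ᵐ ω ∂P, L 1 ω = 0)) (j : ℕ) (hj1 : 1 ≤ j) (hjn : j ≤ n) :
    P.real {ω | failureCountAt L ε ω (systemFailureTime L ε Φ ω) = j} =
        ∑ k ∈ Finset.Icc 1 j, structuralSignature Φ k *
          P.real {ω | failureCountAt L ε ω (orderStatistic (fun i => lifetime L ε i ω) k) = j} ∧
      ∑ k ∈ Finset.Icc 1 j, structuralSignature Φ k *
          P.real {ω | failureCountAt L ε ω (orderStatistic (fun i => lifetime L ε i ω) k) = j} =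
        ∑ k ∈ Finset.Icc 1 j, structuralSignature Φ k * directJumpProb L ε P (k - 1) j ∧
      ∀ k ∈ Finset.Icc 1 j, directJumpProb L ε P (k - 1) j =
        recursiveJumpProb n (laplaceExponent L P) (k - 1) j := by
  have hsys : P.real {ω | failureCountAt L ε ω (systemFailureTime L ε Φ ω) = j} =
      P.real {ω | elapsedCount (rationalLifetimes L ε ω)
        (failureTimeOf Φ (rationalLifetimes L ε ω)) = j} := by
    apply measureReal_congr
    filter_upwards [hmodel.ae_failureCount_eq hL, hmodel.ae_failureCountAt hL] with ω hω hat
    have h1 : systemFailureTime L ε Φ ω = failureTimeOf Φ (rationalLifetimes L ε ω) := by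
      rw [← hω.2.2.2]
      rfl
    refine propext ?_
    change failureCountAt L ε ω (systemFailureTime L ε Φ ω) = j ↔ _
    rw [hat, h1]
    rfl
  have hord : ∀ k, P.real {ω | failureCountAt L ε ω
        (orderStatistic (fun i => lifetime L ε i ω) k) = j} =
      P.real {ω | elapsedCount (rationalLifetimes L ε ω)
        (orderStatistic (rationalLifetimes L ε ω) k) = j} := by
    intro k
    apply measureReal_congr
    filter_upwards [hmodel.ae_failureCount_eq hL, hmodel.ae_failureCountAt hL] with ω hω hat
    refine propext ?_
    change failureCountAt L ε ω (orderStatistic (fun i => lifetime L ε i ω) k) = j ↔ _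
    rw [hat, hω.2.2.2]
    rfl
  have hdirect : ∀ k ∈ Finset.Icc 1 j, directJumpProb L ε P (k - 1) j =
      P.real {ω | elapsedCount (rationalLifetimes L ε ω)
        (orderStatistic (rationalLifetimes L ε ω) k) = j} := by
    intro k hk
    rw [Finset.mem_Icc] at hk
    rw [hmodel.directJumpProb_eq hL (by omega) hjn, Nat.sub_add_cancel hk.1]
  refine ⟨?_, ?_, fun k hk => ?_⟩
  · rw [hsys, hmodel.measureReal_count_failureTimeOf hΦ]
    simp only [hord]
    -- For `k > j` the term vanishes, since at least `k` components have failed at `T_{k:n}`.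
    refine (Finset.sum_subset (Finset.Icc_subset_Icc_right hjn) fun k hk hkj => ?_).symm
    rw [Finset.mem_Icc] at hk hkj
    have hempty : {ω | elapsedCount (rationalLifetimes L ε ω)
        (orderStatistic (rationalLifetimes L ε ω) k) = j} = ∅ := by
      refine Set.eq_empty_of_forall_notMem fun ω hω => ?_
      have h1 := le_elapsedCount_orderStatistic (T := rationalLifetimes L ε ω) hk.1 hk.2
      have h2 : elapsedCount (rationalLifetimes L ε ω)
        (orderStatistic (rationalLifetimes L ε ω) k) = j := hω
      omega
    rw [hempty, measureReal_empty, mul_zero]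
  · exact Finset.sum_congr rfl fun k hk => by rw [hord, hdirect k hk]
  · rw [Finset.mem_Icc] at hk
    rw [hmodel.directJumpProb_eq hL (by omega) hjn]
    exact hmodel.measureReal_count_orderStatistic hL (k - 1) j (by omega) hjn
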